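/- Let $d\ge 2$ be an integer and write $e(t)=e^{2\pi i t}$. For finitely supported $f:\mathbb Z\to\mathbb C$ let $\hat f(\beta)=\sum_n f(n)e(-\beta n)$, and for $g$ on $\mathbb T=\mathbb R/\mathbb Z$ let $g^{\vee}(x)=\int_{\mathbb T} g(\beta)e(\beta x)\,d\beta$, $x\in\mathbb Z$. For positive integers $a,b,q$ let $$S(a/q,b/q)=\frac1q\sum_{r=1}^{q}e\Big(-\frac aq r^d-\frac bq r\Big)$$ be the complete Weyl sum. For $s\ge 1$ and $1\le a\le q\le 2^s$ let $\mathcal R_s(a/q)$ be the set of fractions $b/q$ (not necessarily reduced), $1\le b\le q$, with $\gcd(a,b,q)=1$, if $2^{s-1}\le q<2^s$, and let $\mathcal R_s(a/q)=\emptyset$ otherwise. Let $A$ be a constant, and for each $s\ge1$ let $\varphi_s:\mathbb R\to\mathbb R$ be a smooth even bump function supported in $[-\delta_s,\delta_s]$ for some $0<\delta_s\le 2^{-5s}$ and adapted to this interval, in the sense that $|\varphi_s^{(k)}|\le A\,\delta_s^{-k}$ for $k=0,1,2$ (for instance, $\varphi_s(\xi)=\Phi(\xi/\delta_s)$ with a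 fixed smooth even $\Phi$ supported in $[-1,1]$). Regard $\varphi_s$ as a function on $\mathbb T$ by periodization, and define $$M_sf(x)=\sup_{1\le a\le q\le 2^s}\Big|\sum_{b/q\in\mathcal R_s(a/q)}S(a/q,b/q)\,\big(\varphi_s(\beta-b/q)\hat f(\beta)\big)^{\vee}(x)\Big|,\qquad x\in\mathbb Z .$$ **Proposition.** For every $1<p<\infty$ there is an $\eta=\eta(d,p)>0$, depending only on $d$ and $p$, and a constant $C$, depending only on $d$, $p$ and $A$, such that for all $s\ge1$ and all finitely supported $f:\mathbb Z\to\mathbb C$ $$\|M_sf\|_{\ell^p(\mathbb Z)}\le C\,2^{-\eta s}\,\|f\|_{\ell^p(\mathbb Z)} .$$ Moreover, for $p=2$ and any $\epsilon>0$, the estimate holds with $\eta=\frac1{2d^2}-\epsilon$ and a constant $C$ depending only on $d$, $\epsilon$ and $A$. -/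

import Mathlib

open scoped ContDiff ENNReal
open MeasureTheory

noncomputable section

namespace WeylMax

/-- The additive character `e(t) = exp(2 π i t)`. -/
def e (t : ℝ) : ℂ := Complex.exp (2 * Real.pi * t * Complex.I)

/-- The Fourier transform on `ℤ` of a finitely supported function:
`f̂(β) = ∑ n, f(n) e(-β n)`, a 1-periodic function of `β`. -/
def fourierZ (f : ℤ →₀ ℂ) (β : ℝ) : ℂ := ∑ n ∈ f.support, f n * e (-(β * n))

/-- The inverse Fourier transform of a 1-periodic function `g`:
`g^∨(x) = ∫_𝕋 g(β) e(β x) dβ`, with `𝕋` represented by the interval `(0, 1]`. -/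
def invFourierZ (g : ℝ → ℂ) (x : ℤ) : ℂ := ∫ β in (0 : ℝ)..1, g β * e (β * x)

/-- The complete Weyl sum `S(a/q, b/q) = (1/q) ∑_{1 ≤ r ≤ q} e(-(a/q) r^d - (b/q) r)`. -/
def weylSum (d a b q : ℕ) : ℂ :=
  (1 / (q : ℂ)) * ∑ r ∈ Finset.Icc 1 q,
    e (-((a : ℝ) / q * (r : ℝ) ^ d) - (b : ℝ) / q * r)

/-- The set of frequencies `R_s(a/q) = {b/q ∈ 𝕋 : (a, b, q) = 1, 2^(s-1) ≤ q < 2^s}`, given by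
the numerators `b` in `{1, …, q}`. It is empty unless `2^(s-1) ≤ q < 2^s`. -/
def numerators (s a q : ℕ) : Finset ℕ :=
  (Finset.Icc 1 q).filter
    (fun b => Nat.gcd a (Nat.gcd b q) = 1 ∧ 2 ^ (s - 1) ≤ q ∧ q < 2 ^ s)

/-- A function on the line, regarded as a function on the circle by periodization. -/
def periodize (φ : ℝ → ℝ) (β : ℝ) : ℝ := ∑' l : ℤ, φ (β - l)

/-- The function on `ℤ`
`∑_{b/q ∈ R_s(a/q)} S(a/q, b/q) (φ(β - b/q) f̂(β))^∨`. -/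
def weylMultiplier (d s a q : ℕ) (φ : ℝ → ℝ) (f : ℤ →₀ ℂ) (x : ℤ) : ℂ :=
  ∑ b ∈ numerators s a q,
    weylSum d a b q *
      invFourierZ (fun β => (periodize φ (β - (b : ℝ) / q) : ℂ) * fourierZ f β) x

/-- The maximal function `M_s f(x)`, a supremum over `1 ≤ a ≤ q ≤ 2^s`. -/
def maximalFunction (d s : ℕ) (φ : ℝ → ℝ) (f : ℤ →₀ ℂ) (x : ℤ) : ℝ≥0∞ :=
  ⨆ (q : ℕ) (a : ℕ) (_ : 1 ≤ a ∧ a ≤ q ∧ q ≤ 2 ^ s), ‖weylMultiplier d s a q φ f x‖ₑ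

/-- `φ` is a smooth even bump function supported in `[-δ, δ]` and adapted to this interval, with
normalization constant `A`: its derivatives of order `k ≤ 2` are at most `A δ^(-k)`. For a fixed
smooth even profile `Φ` supported in `[-1, 1]`, all the rescalings `Φ(· / δ)` have this property
with one and the same `A`. -/
structure IsAdaptedBump (A δ : ℝ) (φ : ℝ → ℝ) : Prop where
  smooth : ContDiff ℝ ∞ φ
  even : ∀ ξ, φ (-ξ) = φ ξ
  support : ∀ ξ, δ < |ξ| → φ ξ = 0
  bound : ∀ k : ℕ, k ≤ 2 → ∀ ξ, |iteratedDeriv k φ ξ| ≤ A / δ ^ k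

/-- The estimate `‖M_s f‖_{ℓ^p} ≲ 2^(-η s) ‖f‖_{ℓ^p}`, the implicit constant being uniform in
`s ≥ 1`, in the bump function `φ` adapted to an interval `[-δ, δ]` with `δ ≤ 2^(-5 s)` (for a
fixed normalization constant `A`), and in the finitely supported function `f`. -/
def DecayEstimate (d : ℕ) (p η : ℝ) : Prop :=
  ∀ A : ℝ, ∃ C : ℝ, ∀ s : ℕ, 1 ≤ s → ∀ δ : ℝ, 0 < δ → δ ≤ ((2 : ℝ) ^ (5 * s))⁻¹ →
    ∀ φ : ℝ → ℝ, IsAdaptedBump A δ φ → ∀ f : ℤ →₀ ℂ,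
      eLpNorm (maximalFunction d s φ f) (ENNReal.ofReal p) Measure.count ≤
        ENNReal.ofReal (C * (2 : ℝ) ^ (-(η * s))) *
          eLpNorm (fun x => f x) (ENNReal.ofReal p) Measure.count

end WeylMax

end

open Polynomial

namespace WeylMax

/-! Summing over `b` inverts a finite Fourier transform. For `gcd(a, q) = 1` the multiplier becomes
convolution with `e(-(a/q) m^d) φ^∨(m)`, and for `gcd(a, q) > 1` every admissible Weyl sum vanishes
(`weylSum_eq_zero`). Hence `M_s f(x)` is a finite maximum over reduced fractions, which is
linearized by choosing a maximizing `a(x)/q(x)` for each `x`.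

On `ℓ²` one applies `TT*` and Schur's test. The kernel at `(x, y)` is a sum of the phase `(a/q) w^d
- (a'/q') (w + u)^d`, `u = y - x`, against a product of two bump kernels. The phase has period `q q'
< 2^(2s)`, whereas the bump kernels vary on the scale `1/δ ≥ 2^(5s)`, so up to a negligible error
only the mean of the phase over a period matters (`norm_tsum_periodic_mul_le`). That mean is a
complete exponential sum. Its coefficient of degree `d - 1` is `-a' d u / q'`, whatever `a/q` is, so
the reduced modulus is at least `q' / (d gcd(q', u))` (`exists_norm_sum_range_e_sub_le`). Summation
over `x` then costs only a divisor function of `q'`, and the Schur bound is `2^(-κ s)` for any `κ <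
1/d²`. The square root taken in `TT*` produces the exponent `1/(2d²) - ε`.

The complete sums are bounded by `q^(1-κ)` (`exists_norm_expSum_le`): Mordell's moment argument for
primes, a count of approximate zeros of `F'` for higher prime powers, the Chinese remainder theorem
in general.

For other `p`, the linearized operator is dominated by convolution with an `ℓ¹` weight, which is
bounded on `ℓ¹` and `ℓ^∞` without decay. Interpolation with `ℓ²` (`sum_norm_rpow_le_interp`) leaves
a positive power of the gain. -/

/-! ### Mordell's bound for complete sums over a finite field. -/

lemma addChar_map_sum {A M ι : Type*} [AddCommMonoid A] [CommMonoid M] (ψ : AddChar A M)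
    (s : Finset ι) (f : ι → A) : ψ (∑ i ∈ s, f i) = ∏ i ∈ s, ψ (f i) := by
  classical
  induction s using Finset.induction_on with
  | empty => simp
  | insert a s ha ih => rw [Finset.sum_insert ha, Finset.prod_insert ha, AddChar.map_add_eq_mul, ih]

/-- By Newton's identities the first `d` power sums determine the elementary symmetric functions,
since `1, …, d` are invertible. These are the coefficients of `∏ (X - x_i)`, whose roots recover the
multiset. -/
lemma multiset_map_eq_of_sum_pow_eq {K : Type*} [Field K] {d : ℕ}
    (hK : ∀ k, 1 ≤ k → k ≤ d → (k : K) ≠ 0) (x y : Fin d → K)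
    (h : ∀ j, 1 ≤ j → j ≤ d → ∑ i, x i ^ j = ∑ i, y i ^ j) :
    (Finset.univ.val.map x) = Finset.univ.val.map y := by
  have key : ∀ k, k ≤ d → MvPolynomial.aeval x (MvPolynomial.esymm (Fin d) K k) =
      MvPolynomial.aeval y (MvPolynomial.esymm (Fin d) K k) := by
    intro k
    induction k using Nat.strong_induction_on with
    | _ k ih =>
      intro hk
      rcases Nat.eq_zero_or_pos k with rfl | hpos
      · simp
      · have hN := MvPolynomial.mul_esymm_eq_sum (Fin d) K k
        have hx := congrArg (MvPolynomial.aeval x) hN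
        have hy := congrArg (MvPolynomial.aeval y) hN
        simp only [map_mul, map_natCast, map_pow, map_neg, map_one, map_sum,
          MvPolynomial.psum, MvPolynomial.aeval_X] at hx hy
        have hk0 := hK k hpos hk
        apply mul_left_cancel₀ hk0
        rw [hx, hy]
        congr 1
        refine Finset.sum_congr rfl fun a ha => ?_
        rw [Finset.mem_filter, Finset.HasAntidiagonal.mem_antidiagonal] at ha
        obtain ⟨ha1, ha2⟩ := ha
        rw [ih a.1 ha2 (by omega), h a.2 (by omega) (by omega)]
  have hcard : ∀ z : Fin d → K, (Finset.univ.val.map z).card = d := by simp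
  have hprod : ((Finset.univ.val.map x).map fun t => X - C t).prod =
      ((Finset.univ.val.map y).map fun t => X - C t).prod := by
    rw [Multiset.prod_X_sub_X_eq_sum_esymm, Multiset.prod_X_sub_X_eq_sum_esymm, hcard, hcard]
    refine Finset.sum_congr rfl fun j hj => ?_
    rw [Finset.mem_range] at hj
    rw [← MvPolynomial.aeval_esymm_eq_multiset_esymm (Fin d) K,
      ← MvPolynomial.aeval_esymm_eq_multiset_esymm (Fin d) K, key j (by omega)]
  rw [← Polynomial.roots_multiset_prod_X_sub_C (Finset.univ.val.map x), hprod,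
    Polynomial.roots_multiset_prod_X_sub_C]

lemma card_sum_pow_eq_le {K : Type*} [Field K] [Fintype K] [DecidableEq K] {d : ℕ}
    (hK : ∀ k, 1 ≤ k → k ≤ d → (k : K) ≠ 0) (y : Fin d → K) :
    (Finset.univ.filter fun x : Fin d → K =>
      (fun j : Fin d => ∑ i, x i ^ (j.val + 1)) = fun j => ∑ i, y i ^ (j.val + 1)).card
      ≤ d.factorial := by
  calc _ ≤ ((List.ofFn y).permutations.toFinset).card := by
        refine Finset.card_le_card_of_injOn List.ofFn (fun x hx => ?_)
          (fun a _ b _ hab => List.ofFn_injective hab)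
        simp only [Finset.coe_filter, Finset.mem_univ, true_and, Set.mem_ofPred_eq] at hx
        have := multiset_map_eq_of_sum_pow_eq hK x y (fun j h1 h2 => by
          have := congrFun hx ⟨j - 1, by omega⟩
          simpa [Nat.sub_add_cancel h1] using this)
        rw [Fin.univ_val_map, Fin.univ_val_map, Multiset.coe_eq_coe] at this
        simpa using this
    _ ≤ _ := (List.toFinset_card_le _).trans (by simp [List.length_permutations])

lemma sum_addChar_dot {K : Type*} [Field K] [Fintype K] [DecidableEq K] {ψ : AddChar K ℂ}
    (hψ : ψ.IsPrimitive) {d : ℕ} (v : Fin d → K) :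
    ∑ c : Fin d → K, ψ (∑ j, c j * v j) = if v = 0 then (Fintype.card K : ℂ) ^ d else 0 := by
  simp_rw [addChar_map_sum]
  rw [← Fintype.piFinset_univ, ← Finset.prod_univ_sum (fun _ => Finset.univ)
    (fun j t => ψ (t * v j))]
  simp_rw [AddChar.sum_mulShift _ hψ]
  split_ifs with h
  · simp [h]
  · obtain ⟨j, hj⟩ := Function.ne_iff.1 h
    exact Finset.prod_eq_zero (Finset.mem_univ j) (by simpa using hj)

lemma sum_norm_sq_addChar_dot {K : Type*} [Field K] [Fintype K] [DecidableEq K] {ψ : AddChar K ℂ}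
    (hψ : ψ.IsPrimitive) {d : ℕ} {Y : Type*} [Fintype Y] (P : Y → Fin d → K) :
    ∑ c : Fin d → K, ‖∑ x, ψ (∑ j, c j * P x j)‖ ^ 2 =
      (Fintype.card K : ℝ) ^ d * ∑ y, ((Finset.univ.filter fun x => P x = P y).card : ℝ) := by
  apply Complex.ofReal_injective
  push_cast
  have : ∀ c : Fin d → K, ((‖∑ x, ψ (∑ j, c j * P x j)‖ : ℂ)) ^ 2 =
      ∑ y, ∑ x, ψ (∑ j, c j * (P x - P y) j) := by
    intro c
    rw [← Complex.mul_conj', map_sum, Finset.sum_mul_sum, Finset.sum_comm]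
    refine Finset.sum_congr rfl fun y _ => Finset.sum_congr rfl fun x _ => ?_
    rw [← AddChar.map_neg_eq_conj, ← AddChar.map_add_eq_mul]
    congr 1
    simp only [Pi.sub_apply, mul_sub, Finset.sum_sub_distrib]
    rw [sub_eq_add_neg]
  simp_rw [this]
  rw [Finset.sum_comm, Finset.mul_sum]
  refine Finset.sum_congr rfl fun y _ => ?_
  rw [Finset.sum_comm]
  simp_rw [sum_addChar_dot hψ, sub_eq_zero]
  rw [← Finset.sum_filter, Finset.sum_const, nsmul_eq_mul, mul_comm]

/-- Expanding the power and using orthogonality, the moment counts pairs of `d`-tuples with equal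
power sums. Such tuples are permutations of each other. -/
lemma mordell_moment {K : Type*} [Field K] [Fintype K] [DecidableEq K] {ψ : AddChar K ℂ}
    (hψ : ψ.IsPrimitive) {d : ℕ} (hK : ∀ k, 1 ≤ k → k ≤ d → (k : K) ≠ 0) :
    ∑ c : Fin d → K, ‖∑ x : K, ψ (∑ j, c j * x ^ (j.val + 1))‖ ^ (2 * d) ≤
      (Fintype.card K : ℝ) ^ (2 * d) * d.factorial := by
  have h1 : ∀ c : Fin d → K, ‖∑ x : K, ψ (∑ j, c j * x ^ (j.val + 1))‖ ^ (2 * d) =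
      ‖∑ x : Fin d → K, ψ (∑ j, c j * (fun j : Fin d => ∑ i, x i ^ (j.val + 1)) j)‖ ^ 2 := by
    intro c
    rw [mul_comm 2 d, pow_mul, ← norm_pow, Fintype.sum_pow]
    refine congrArg (fun z : ℂ => ‖z‖ ^ 2) (Finset.sum_congr rfl fun x _ => ?_)
    rw [← addChar_map_sum ψ Finset.univ]
    congr 1
    simp only [Finset.mul_sum]
    rw [Finset.sum_comm]
  simp_rw [h1]
  rw [sum_norm_sq_addChar_dot hψ (fun x : Fin d → K => fun j : Fin d => ∑ i, x i ^ (j.val + 1)),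
    two_mul, pow_add, mul_assoc]
  gcongr
  calc _ ≤ ∑ y : Fin d → K, (d.factorial : ℝ) :=
        Finset.sum_le_sum fun y _ => by exact_mod_cast card_sum_pow_eq_le hK y
    _ = _ := by simp

/-- The coefficient is affine in `b`, with slope `m + 1` times the leading coefficient of `f`. -/
lemma taylor_coeff_injective {K : Type*} [Field K] {f : K[X]} {m : ℕ} (hm : f.natDegree = m + 1)
    (hmK : ((m + 1 : ℕ) : K) ≠ 0) :
    Function.Injective fun b : K => (taylor b f).coeff m := by
  have key : ∀ b, (taylor b f).coeff m = f.coeff m + (m + 1 : ℕ) * f.coeff (m + 1) * b := by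
    intro b
    rw [taylor_coeff, Polynomial.eval_eq_sum_range' (n := 2)
      (Nat.lt_succ_of_le ((natDegree_hasseDeriv_le f m).trans (by omega)))]
    simp [Finset.sum_range_succ, hasseDeriv_coeff, add_comm 1 m]
  have hlead : f.coeff (m + 1) ≠ 0 := by
    rw [← hm, coeff_natDegree, Ne, leadingCoeff_eq_zero]
    rintro rfl
    simp at hm
  intro b b' h
  simp only [key] at h
  exact mul_left_cancel₀ (mul_ne_zero hmK hlead) (add_left_cancel h)

/-- The translates `f(X + b)` all give sums of the same modulus, and for degree at least 2 their
nonconstant coefficients are distinct vectors. The sum therefore occurs `|K|` times in the moment of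
`mordell_moment`. -/
lemma mordell_bound {K : Type*} [Field K] [Fintype K] [DecidableEq K] {ψ : AddChar K ℂ}
    (hψ : ψ.IsPrimitive) {d : ℕ} (hK : ∀ k, 1 ≤ k → k ≤ d → (k : K) ≠ 0) (f : K[X])
    (hf1 : 1 ≤ f.natDegree) (hf2 : f.natDegree ≤ d) :
    (Fintype.card K : ℝ) * ‖∑ x : K, ψ (f.eval x)‖ ^ (2 * d) ≤
      (Fintype.card K : ℝ) ^ (2 * d) * d.factorial := by
  set S : (Fin d → K) → ℝ := fun c => ‖∑ x : K, ψ (∑ j, c j * x ^ (j.val + 1))‖ ^ (2 * d) with hS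
  set T : K → Fin d → K := fun b j => (taylor b f).coeff (j.val + 1) with hT
  have hST : ∀ b, S (T b) = ‖∑ x : K, ψ (f.eval x)‖ ^ (2 * d) := by
    intro b
    have h1 : ∀ x, ψ (f.eval (x + b)) = ψ ((taylor b f).coeff 0) *
        ψ (∑ j, T b j * x ^ (j.val + 1)) := by
      intro x
      rw [← AddChar.map_add_eq_mul, ← taylor_eval, Polynomial.eval_eq_sum_range' (n := d + 1)
        (by rw [natDegree_taylor]; omega), Finset.sum_range_succ', Finset.sum_range, add_comm]
      simp [hT]
    rw [← Equiv.sum_comp (Equiv.addRight b) (fun x => ψ (f.eval x))]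
    simp only [Equiv.coe_addRight, h1, ← Finset.mul_sum, norm_mul, AddChar.norm_apply, one_mul, hS]
  obtain ⟨m, hm⟩ : ∃ m, f.natDegree = m + 1 := ⟨f.natDegree - 1, by omega⟩
  -- `T` omits the constant coefficient, so it does not separate the translates of a linear `f`. In
  -- that case the sum is zero by orthogonality.
  rcases Nat.eq_zero_or_pos m with rfl | hmpos
  · have hlead : f.coeff 1 ≠ 0 := by
      intro h
      have : f.leadingCoeff = 0 := by rw [leadingCoeff, hm]; exact h
      rw [leadingCoeff_eq_zero] at this
      simp [this] at hm
    have : ∑ x : K, ψ (f.eval x) = 0 := by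
      have : ∀ x, ψ (f.eval x) = ψ (f.coeff 0) * ψ (x * f.coeff 1) := by
        intro x
        rw [← AddChar.map_add_eq_mul, Polynomial.eval_eq_sum_range, hm]
        simp [Finset.sum_range_succ, mul_comm]
      simp_rw [this, ← Finset.mul_sum, AddChar.sum_mulShift _ hψ]
      simp [hlead]
    rw [this, norm_zero, zero_pow (by omega), mul_zero]
    positivity
  · have hTinj : Function.Injective T := by
      intro b b' h
      apply taylor_coeff_injective hm (hK _ (by omega) (by omega))
      have := congrFun h ⟨m - 1, by omega⟩
      simpa [hT, Nat.sub_add_cancel hmpos] using this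
    calc _ = ∑ b : K, S (T b) := by simp [hST]
      _ = ∑ c ∈ Finset.univ.image T, S c := (Finset.sum_image hTinj.injOn).symm
      _ ≤ ∑ c, S c := Finset.sum_le_sum_of_subset_of_nonneg (Finset.subset_univ _)
          (fun _ _ _ => by positivity)
      _ ≤ _ := mordell_moment hψ hK

/-! ### Complete sums modulo prime powers. -/

lemma pow_dvd_of_pow_dvd_mul_of_not_pow_dvd {p : ℤ} (hp : Prime p) {a b : ℤ} {n r : ℕ}
    (ha : ¬ p ^ (r + 1) ∣ a) (h : p ^ n ∣ a * b) : p ^ (n - r) ∣ b := by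
  have ha0 : a ≠ 0 := by rintro rfl; exact ha (dvd_zero _)
  obtain ⟨v, a', hpa', rfl⟩ : ∃ v, ∃ a', ¬ p ∣ a' ∧ a = p ^ v * a' := by
    obtain ⟨a', h1, h2⟩ :=
      (FiniteMultiplicity.of_prime_left hp ha0).exists_eq_pow_mul_and_not_dvd
    exact ⟨_, a', h2, h1⟩
  have hv : v ≤ r := by
    by_contra! hv
    exact ha ((pow_dvd_pow p hv).mul_right a')
  rcases le_total n v with hnv | hnv
  · simp [Nat.sub_eq_zero_of_le (hnv.trans hv)]
  · rw [mul_assoc, ← Nat.add_sub_cancel' hnv, pow_add] at h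
    have h' := hp.pow_dvd_of_dvd_mul_left _ hpa' (Int.dvd_of_mul_dvd_mul_left (pow_ne_zero _ hp.ne_zero) h)
    exact (pow_dvd_pow p (by omega)).trans h'

/-- A `p`-adic form of the bound on the number of roots. Dividing out `X - a` at one of the points
costs at most `p^r` at each of the others, and the quotient has lower degree. -/
lemma C_pow_dvd_of_pow_dvd_eval {p : ℤ} (hp : Prime p) (n r k : ℕ) (G : ℤ[X])
    (hG : G.natDegree ≤ k) (s : Finset ℤ) (hs : s.card = k + 1)
    (hsG : ∀ x ∈ s, p ^ n ∣ G.eval x)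
    (hsep : ∀ x ∈ s, ∀ y ∈ s, x ≠ y → ¬ p ^ (r + 1) ∣ x - y) :
    C (p ^ (n - k * r)) ∣ G := by
  induction k generalizing n G s with
  | zero =>
    obtain ⟨x, rfl⟩ := Finset.card_eq_one.1 hs
    rw [eq_C_of_natDegree_le_zero hG]
    have := hsG x (by simp)
    rw [eq_C_of_natDegree_le_zero hG, eval_C] at this
    simpa using _root_.map_dvd C this
  | succ k ih =>
    obtain ⟨a, ha⟩ : s.Nonempty := Finset.card_pos.1 (by omega)
    have hdiv : G = C (G.eval a) + (X - C a) * (G /ₘ (X - C a)) := by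
      rw [← modByMonic_X_sub_C_eq_C_eval]
      exact (modByMonic_add_div G (X - C a)).symm
    set G₁ := G /ₘ (X - C a) with hG₁
    have hdeg : G₁.natDegree ≤ k := by
      rw [hG₁, natDegree_divByMonic G (monic_X_sub_C a), natDegree_X_sub_C]; omega
    have h1 : C (p ^ (n - r - k * r)) ∣ G₁ := by
      refine ih (n - r) G₁ hdeg (s.erase a) (by rw [Finset.card_erase_of_mem ha, hs]; rfl) ?_
        (fun x hx y hy => hsep x (Finset.mem_of_mem_erase hx) y (Finset.mem_of_mem_erase hy))
      intro x hx
      obtain ⟨hxa, hxs⟩ := Finset.mem_erase.1 hx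
      refine pow_dvd_of_pow_dvd_mul_of_not_pow_dvd hp (hsep x hxs a ha hxa) ?_
      have h2 : G.eval x = G.eval a + (x - a) * G₁.eval x := by
        conv_lhs => rw [hdiv]
        simp
      rw [show (x - a) * G₁.eval x = G.eval x - G.eval a by rw [h2]; ring]
      exact dvd_sub (hsG x hxs) (hsG a ha)
    have hexp : n - (k + 1) * r = n - r - k * r := by rw [Nat.sub_sub, add_mul, one_mul, add_comm]
    rw [hexp]
    refine hdiv ▸ dvd_add (_root_.map_dvd C ?_) (h1.mul_left _)
    exact (pow_dvd_pow p (by omega)).trans (hsG a ha)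

/-- The complete exponential sum attached to an integer polynomial and an additive character. -/
def expSum {R : Type*} [CommRing R] [Fintype R] (ψ : AddChar R ℂ) (F : ℤ[X]) : ℂ :=
  ∑ x : R, ψ (F.eval₂ (Int.castRingHom R) x)

lemma norm_expSum_le_card {R : Type*} [CommRing R] [Fintype R] (ψ : AddChar R ℂ) (F : ℤ[X]) :
    ‖expSum ψ F‖ ≤ Fintype.card R :=
  (norm_sum_le _ _).trans (by simp)

/-- Average over the shifts `x ↦ x + t y`. As `t² = 0`, the Taylor expansion stops at the linear
term, and orthogonality in `y` keeps only the points where `F'(x) t = 0`. -/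
lemma norm_expSum_le_card_filter {R : Type*} [CommRing R] [Fintype R] [DecidableEq R]
    {ψ : AddChar R ℂ} (hψ : ψ.IsPrimitive) (F : ℤ[X]) (t : R) (ht : t ^ 2 = 0) :
    ‖expSum ψ F‖ ≤ (Finset.univ.filter fun x : R =>
      (derivative F).eval₂ (Int.castRingHom R) x * t = 0).card := by
  have hshift : ∀ y : R, expSum ψ F = ∑ x : R, ψ (F.eval₂ (Int.castRingHom R) x) *
      ψ (y * ((derivative F).eval₂ (Int.castRingHom R) x * t)) := by
    intro y
    rw [expSum, ← Equiv.sum_comp (Equiv.addRight (t * y))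
      (fun x => ψ (F.eval₂ (Int.castRingHom R) x))]
    refine Finset.sum_congr rfl fun x _ => ?_
    rw [← AddChar.map_add_eq_mul, Equiv.coe_addRight, ← eval_map, eval_add_of_sq_eq_zero _ _ _
      (by rw [mul_pow, ht, zero_mul]), derivative_map, eval_map, eval_map]
    congr 2
    ring
  have hcard : (0 : ℝ) < Fintype.card R := by exact_mod_cast Fintype.card_pos
  have hsum : (Fintype.card R : ℂ) * expSum ψ F = (Fintype.card R : ℂ) *
      ∑ x ∈ Finset.univ.filter fun x : R =>
        (derivative F).eval₂ (Int.castRingHom R) x * t = 0, ψ (F.eval₂ (Int.castRingHom R) x) := by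
    calc _ = ∑ y : R, expSum ψ F := by simp
      _ = ∑ x : R, ψ (F.eval₂ (Int.castRingHom R) x) * ∑ y : R,
          ψ (y * ((derivative F).eval₂ (Int.castRingHom R) x * t)) := by
        rw [Finset.sum_congr rfl fun y _ => hshift y, Finset.sum_comm]
        simp_rw [Finset.mul_sum]
      _ = _ := by
        simp_rw [AddChar.sum_mulShift _ hψ]
        rw [Finset.sum_filter, Finset.mul_sum]
        refine Finset.sum_congr rfl fun x _ => ?_
        split_ifs <;> simp [mul_comm]
  rw [mul_right_inj' (by exact_mod_cast hcard.ne')] at hsum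
  rw [hsum]
  exact (norm_sum_le _ _).trans (by simp)

lemma card_le_mul_pow_of_image_mod {p l r k : ℕ} (hp : 0 < p) (hrl : r ≤ l) [NeZero (p ^ l)]
    (E : Finset (ZMod (p ^ l))) (hE : (E.image fun x => x.val % p ^ r).card ≤ k) :
    E.card ≤ k * p ^ (l - r) := by
  rw [mul_comm]
  refine (Finset.card_le_mul_card_image E (p ^ (l - r)) fun c _ => ?_).trans
    (Nat.mul_le_mul_left _ hE)
  rw [← Finset.card_range (p ^ (l - r))]
  refine Finset.card_le_card_of_injOn (fun x => x.val / p ^ r) (fun x _ => ?_) ?_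
  · simp only [Finset.coe_range, Set.mem_Iio]
    rw [Nat.div_lt_iff_lt_mul (pow_pos hp r), ← pow_add, Nat.sub_add_cancel hrl]
    exact ZMod.val_lt x
  · intro x hx y hy hxy
    simp only [Finset.coe_filter, Set.mem_ofPred_eq] at hx hy
    apply ZMod.val_injective
    rw [← Nat.div_add_mod x.val (p ^ r), ← Nat.div_add_mod y.val (p ^ r), hx.2, hy.2]
    simp only at hxy
    rw [hxy]

lemma eval₂_castRingHom_intCast {R : Type*} [CommRing R] (F : ℤ[X]) (x : ℤ) :
    F.eval₂ (Int.castRingHom R) (x : R) = ((F.eval x : ℤ) : R) := by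
  rw [← eq_intCast (Int.castRingHom R) x, eval₂_at_apply, eq_intCast]

/-- If the solutions of `p^(l/2) ∣ F'(x)` met `d` classes modulo `p^(R+1)`, a high power of `p`
would divide `F'`. This is impossible, because some nonconstant coefficient of `F` is prime to `p`
and differentiation multiplies it by at most `d`. -/
lemma card_derivative_mul_pow_eq_zero_le {p l d t : ℕ} (hp : p.Prime) [NeZero (p ^ l)]
    (hd : 2 ≤ d) (ht : d < p ^ (t + 1)) (htl : t < l / 2) (F : ℤ[X]) (hF : F.natDegree ≤ d)
    (hFp : ∃ j, 1 ≤ j ∧ ¬ (p : ℤ) ∣ F.coeff j) :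
    (Finset.univ.filter fun x : ZMod (p ^ l) =>
      (derivative F).eval₂ (Int.castRingHom _) x * (p : ZMod (p ^ l)) ^ (l - l / 2) = 0).card ≤
      (d - 1) * p ^ (l - ((l / 2 - t - 1) / (d - 1) + 1)) := by
  set n := l / 2 with hn
  set R := (n - t - 1) / (d - 1) with hR
  have hRle : R * (d - 1) ≤ n - t - 1 := Nat.div_mul_le_self _ _
  have hRn : R ≤ n - t - 1 := Nat.div_le_self _ _
  have hpZ : Prime (p : ℤ) := Nat.prime_iff_prime_int.1 hp
  have hnl : n ≤ l := Nat.div_le_self _ _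
  refine card_le_mul_pow_of_image_mod hp.pos (by omega) _ ?_
  by_contra! hcard
  obtain ⟨I, hIsub, hIcard⟩ := Finset.exists_subset_card_eq
    (Nat.succ_le_of_lt hcard)
  have hI : ∀ c ∈ I, ∃ x : ZMod (p ^ l), (derivative F).eval₂ (Int.castRingHom _) x *
      (p : ZMod (p ^ l)) ^ (l - n) = 0 ∧ x.val % p ^ (R + 1) = c := by
    intro c hc
    simpa using hIsub hc
  choose! g hg0 hgc using hI
  have hinj : Set.InjOn (fun c => ((g c).val : ℤ)) I := by
    intro c hc c' hc' h
    rw [← hgc c hc, ← hgc c' hc']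
    simp only [Nat.cast_inj] at h
    rw [h]
  have hdvd := C_pow_dvd_of_pow_dvd_eval hpZ n R (d - 1) (derivative F)
    ((natDegree_derivative_le F).trans (Nat.sub_le_sub_right hF 1))
    (I.image fun c => ((g c).val : ℤ))
    (by rw [Finset.card_image_of_injOn hinj, hIcard]) ?_ ?_
  · obtain ⟨j, hj1, hj⟩ := hFp
    have hjd : j ≤ d := by
      by_contra! hjd
      exact hj (by rw [coeff_eq_zero_of_natDegree_lt (by omega)]; exact dvd_zero _)
    -- The choice of `R` ensures `n - (d - 1) R ≥ t + 1`. Then `p^(t+1)` divides `j F_j`, hence `j`,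
    -- although `j ≤ d < p^(t+1)`.
    have h1 : (p : ℤ) ^ (t + 1) ∣ (derivative F).coeff (j - 1) := by
      refine (pow_dvd_pow _ ?_).trans ((C_dvd_iff_dvd_coeff _ _).1 hdvd (j - 1))
      rw [mul_comm (d - 1)]; omega
    rw [coeff_derivative, Nat.sub_add_cancel hj1] at h1
    have h2 := hpZ.pow_dvd_of_dvd_mul_left _ hj h1
    have h3 : ((j - 1 : ℕ) : ℤ) + 1 = (j : ℤ) := by omega
    rw [h3] at h2
    have h4 : p ^ (t + 1) ∣ j := by exact_mod_cast h2
    exact absurd (Nat.le_of_dvd (by omega) h4) (by omega)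
  · intro x hx
    obtain ⟨c, hc, rfl⟩ := Finset.mem_image.1 hx
    have h0 := hg0 c hc
    have h1 : g c = (((g c).val : ℤ) : ZMod (p ^ l)) := by simp
    rw [h1, eval₂_castRingHom_intCast] at h0
    have h2 : (((derivative F).eval ((g c).val : ℤ) * (p : ℤ) ^ (l - n) : ℤ) : ZMod (p ^ l)) = 0 := by
      push_cast at h0 ⊢
      exact h0
    rw [ZMod.intCast_zmod_eq_zero_iff_dvd] at h2
    push_cast at h2
    refine Int.dvd_of_mul_dvd_mul_right (a := (p : ℤ) ^ (l - n)) (pow_ne_zero _ hpZ.ne_zero) ?_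
    rwa [← pow_add, Nat.add_sub_cancel' hnl]
  · intro x hx y hy hxy hdiv
    obtain ⟨c, hc, rfl⟩ := Finset.mem_image.1 hx
    obtain ⟨c', hc', rfl⟩ := Finset.mem_image.1 hy
    apply hxy
    have : (g c').val ≡ (g c).val [MOD p ^ (R + 1)] :=
      (Nat.modEq_iff_dvd).2 (by exact_mod_cast hdiv)
    rw [Nat.ModEq, hgc c hc, hgc c' hc'] at this
    rw [this]

/-! ### Multiplicativity and complete sums to an arbitrary modulus. -/

lemma expSum_equiv {R R' : Type*} [CommRing R] [Fintype R] [CommRing R'] [Fintype R']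
    (e : R ≃+* R') (ψ : AddChar R ℂ) (F : ℤ[X]) :
    expSum ψ F = expSum (ψ.compAddMonoidHom (e.symm : R' →+ R)) F := by
  rw [expSum, expSum, ← Equiv.sum_comp e.symm.toEquiv]
  refine Finset.sum_congr rfl fun x _ => ?_
  simp only [AddChar.compAddMonoidHom_apply, RingEquiv.toEquiv_eq_coe, EquivLike.coe_coe]
  congr 1
  have := hom_eval₂ F (Int.castRingHom R') (e.symm : R' →+* R) x
  rw [Subsingleton.elim ((e.symm : R' →+* R).comp (Int.castRingHom R')) (Int.castRingHom R)] at this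
  exact this.symm

lemma expSum_prod {R R' : Type*} [CommRing R] [Fintype R] [CommRing R'] [Fintype R']
    (ψ : AddChar (R × R') ℂ) (F : ℤ[X]) :
    expSum ψ F = expSum (ψ.compAddMonoidHom (AddMonoidHom.inl R R')) F *
      expSum (ψ.compAddMonoidHom (AddMonoidHom.inr R R')) F := by
  rw [expSum, expSum, expSum, Finset.sum_mul_sum, ← Finset.sum_product', Finset.univ_product_univ]
  refine Finset.sum_congr rfl fun x _ => ?_
  simp only [AddChar.compAddMonoidHom_apply, AddMonoidHom.inl_apply, AddMonoidHom.inr_apply]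
  rw [← AddChar.map_add_eq_mul]
  congr 1
  have h1 := hom_eval₂ F (Int.castRingHom (R × R')) (RingHom.fst R R') x
  have h2 := hom_eval₂ F (Int.castRingHom (R × R')) (RingHom.snd R R') x
  rw [Subsingleton.elim ((RingHom.fst R R').comp (Int.castRingHom _)) (Int.castRingHom R)] at h1
  rw [Subsingleton.elim ((RingHom.snd R R').comp (Int.castRingHom _)) (Int.castRingHom R')] at h2
  rw [Prod.mk_add_mk, add_zero, zero_add]
  exact Prod.ext h1 h2

lemma isPrimitive_equiv {R R' : Type*} [CommRing R] [CommRing R'] (e : R ≃+* R')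
    {ψ : AddChar R ℂ} (hψ : ψ.IsPrimitive) :
    (ψ.compAddMonoidHom (e.symm : R' →+ R)).IsPrimitive := by
  intro a ha h
  refine hψ (a := e.symm a) (by simpa using ha) ?_
  ext x
  have := DFunLike.congr_fun h (e x)
  simpa [AddChar.mulShift_apply] using this

lemma isPrimitive_inl {R R' : Type*} [CommRing R] [CommRing R']
    {ψ : AddChar (R × R') ℂ} (hψ : ψ.IsPrimitive) :
    (ψ.compAddMonoidHom (AddMonoidHom.inl R R')).IsPrimitive := by
  intro a ha h
  refine hψ (a := (a, 0)) (by simpa using ha) ?_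
  ext x
  have := DFunLike.congr_fun h x.1
  rw [AddChar.mulShift_apply, ← Prod.mk.eta (p := x), Prod.mk_mul_mk, zero_mul]
  simpa [AddChar.mulShift_apply] using this

lemma isPrimitive_inr {R R' : Type*} [CommRing R] [CommRing R']
    {ψ : AddChar (R × R') ℂ} (hψ : ψ.IsPrimitive) :
    (ψ.compAddMonoidHom (AddMonoidHom.inr R R')).IsPrimitive := by
  intro a ha h
  refine hψ (a := (0, a)) (by simpa using ha) ?_
  ext x
  have := DFunLike.congr_fun h x.2
  rw [AddChar.mulShift_apply, ← Prod.mk.eta (p := x), Prod.mk_mul_mk, zero_mul]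
  simpa [AddChar.mulShift_apply] using this

/-- Mordell's bound saves `p^(1/(2d))`, which is at least `p^(1/d²)` because `d ≥ 2`. For `p ≤ d`
the trivial bound is absorbed by the constant. -/
lemma norm_expSum_prime_le {p d : ℕ} [NeZero p] (hp : p.Prime) (hd : 2 ≤ d) {ψ : AddChar (ZMod p) ℂ}
    (hψ : ψ.IsPrimitive) (F : ℤ[X]) (hF : F.natDegree ≤ d)
    (hFp : ∃ j, 1 ≤ j ∧ ¬ (p : ℤ) ∣ F.coeff j) :
    ‖expSum ψ F‖ * (p : ℝ) ^ (1 / (d : ℝ) ^ 2) ≤ d ^ 2 * d.factorial * p := by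
  have hp1 : (1 : ℝ) ≤ p := by exact_mod_cast hp.one_le
  have hd2 : (2 : ℝ) ≤ d := by exact_mod_cast hd
  have hfac : (1 : ℝ) ≤ d.factorial := by exact_mod_cast d.factorial_pos
  have hdsq : (1 : ℝ) ≤ (d : ℝ) ^ 2 := by nlinarith
  rcases le_or_gt p d with hpd | hpd
  · have h1 : ‖expSum ψ F‖ ≤ p := by simpa using norm_expSum_le_card ψ F
    have h2 : (p : ℝ) ^ (1 / (d : ℝ) ^ 2) ≤ d := by
      calc (p : ℝ) ^ (1 / (d : ℝ) ^ 2) ≤ (p : ℝ) ^ (1 : ℝ) :=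
            Real.rpow_le_rpow_of_exponent_le hp1 (by rw [div_le_one (by positivity)]; exact hdsq)
        _ ≤ d := by rw [Real.rpow_one]; exact_mod_cast hpd
    calc _ ≤ (p : ℝ) * d := by gcongr
      _ = d * 1 * p := by ring
      _ ≤ d ^ 2 * d.factorial * p := by gcongr; nlinarith
  · have : Fact p.Prime := ⟨hp⟩
    set f : (ZMod p)[X] := F.map (Int.castRingHom _) with hf
    have hfdeg : f.natDegree ≤ d := natDegree_map_le.trans hF
    have hf1 : 1 ≤ f.natDegree := by
      obtain ⟨j, hj1, hj⟩ := hFp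
      refine hj1.trans (le_natDegree_of_ne_zero ?_)
      rw [hf, coeff_map, eq_intCast, Ne, ZMod.intCast_zmod_eq_zero_iff_dvd]
      exact hj
    have key := mordell_bound hψ (d := d) (fun k hk1 hk2 => by
      rw [Ne, ZMod.natCast_eq_zero_iff]
      exact fun h => absurd (Nat.le_of_dvd hk1 h) (by omega)) f hf1 hfdeg
    have hS : ∑ x : ZMod p, ψ (f.eval x) = expSum ψ F := by simp [expSum, hf, eval_map]
    rw [hS, ZMod.card] at key
    have hle : ‖expSum ψ F‖ * (p : ℝ) ^ (1 / (d : ℝ) ^ 2) ≤ p * d.factorial := by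
      refine le_of_pow_le_pow_left₀ (n := 2 * d) (by omega) (by positivity) ?_
      calc (‖expSum ψ F‖ * (p : ℝ) ^ (1 / (d : ℝ) ^ 2)) ^ (2 * d)
          = ‖expSum ψ F‖ ^ (2 * d) * (p : ℝ) ^ (2 / (d : ℝ)) := by
            rw [mul_pow, ← Real.rpow_natCast ((p : ℝ) ^ _), ← Real.rpow_mul (by positivity)]
            congr 2
            push_cast
            field_simp
        _ ≤ ‖expSum ψ F‖ ^ (2 * d) * (p : ℝ) ^ (1 : ℝ) := by
            gcongr
            rw [div_le_one (by positivity)]; exact hd2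
        _ ≤ (p : ℝ) ^ (2 * d) * d.factorial := by rw [Real.rpow_one, mul_comm]; exact key
        _ ≤ (p : ℝ) ^ (2 * d) * (d.factorial : ℝ) ^ (2 * d) := by
            gcongr
            exact le_self_pow₀ hfac (by omega)
        _ = _ := by rw [mul_pow]
    refine hle.trans ?_
    rw [mul_comm (p : ℝ)]
    gcongr
    nlinarith

lemma norm_expSum_prime_pow_le {p l d : ℕ} [NeZero (p ^ l)] (hp : p.Prime) (hl : 2 ≤ l) (hd : 2 ≤ d)
    {ψ : AddChar (ZMod (p ^ l)) ℂ} (hψ : ψ.IsPrimitive) (F : ℤ[X]) (hF : F.natDegree ≤ d)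
    (hFp : ∃ j, 1 ≤ j ∧ ¬ (p : ℤ) ∣ F.coeff j) :
    ‖expSum ψ F‖ * ((p ^ l : ℕ) : ℝ) ^ (1 / (d : ℝ) ^ 2) ≤ d ^ 2 * (p ^ l : ℕ) := by
  set t := Nat.log p d with ht
  have hpt : p ^ t ≤ d := Nat.pow_log_le_self p (by omega)
  have hpt' : d < p ^ (t + 1) := Nat.lt_pow_succ_log_self hp.one_lt d
  have hp1 : (1 : ℝ) ≤ p := by exact_mod_cast hp.one_le
  have hd2 : (2 : ℝ) ≤ d := by exact_mod_cast hd
  -- For `l ≥ 2` one has `l ≤ 3 ⌊l/2⌋`, and `3 (d - 1) ≤ d²`. This is where the exponent `1/d²`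
  -- covers the rounding in `l / 2`.
  have hexp : ∀ M : ℕ, l / 2 ≤ M * (d - 1) →
      ((p ^ l : ℕ) : ℝ) ^ (1 / (d : ℝ) ^ 2) ≤ (p : ℝ) ^ M := by
    intro M hM
    rw [Nat.cast_pow, ← Real.rpow_natCast (p : ℝ) l, ← Real.rpow_mul (by positivity),
      ← Real.rpow_natCast (p : ℝ) M]
    apply Real.rpow_le_rpow_of_exponent_le hp1
    rw [mul_one_div, div_le_iff₀ (by positivity)]
    have h1 : l ≤ 3 * (M * (d - 1)) := by omega
    have h2 : 3 * (d - 1) ≤ d ^ 2 := by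
      obtain ⟨e, rfl⟩ := Nat.exists_eq_add_of_le hd
      simp only [show 2 + e - 1 = e + 1 by omega]
      nlinarith
    have h3 : l ≤ M * d ^ 2 := by nlinarith
    exact_mod_cast h3
  have hptR : (p : ℝ) ^ t ≤ d := by exact_mod_cast hpt
  rcases le_or_gt (l / 2) t with htl | htl
  · calc _ ≤ ((p ^ l : ℕ) : ℝ) * (d : ℝ) ^ 2 := by
          gcongr
          · simpa using norm_expSum_le_card ψ F
          · exact (hexp t (htl.trans (Nat.le_mul_of_pos_right t (by omega)))).trans (by nlinarith)
      _ = _ := mul_comm _ _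
  · set r := (l / 2 - t - 1) / (d - 1) + 1 with hr
    have hr1 : l / 2 - t ≤ r * (d - 1) := by
      have := Nat.lt_div_mul_add (a := l / 2 - t - 1) (b := d - 1) (by omega)
      rw [hr, add_mul]; omega
    have hrl : r ≤ l := by
      have := Nat.div_le_self (l / 2 - t - 1) (d - 1)
      omega
    have h1 : ‖expSum ψ F‖ ≤ ((d - 1 : ℕ) : ℝ) * (p : ℝ) ^ (l - r) := by
      have h2 := norm_expSum_le_card_filter hψ F ((p : ZMod (p ^ l)) ^ (l - l / 2)) (by
        rw [← pow_mul, ← Nat.cast_pow, ZMod.natCast_eq_zero_iff]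
        exact pow_dvd_pow p (by omega))
      refine h2.trans ?_
      exact_mod_cast card_derivative_mul_pow_eq_zero_le hp hd hpt' htl F hF hFp
    calc _ ≤ (((d - 1 : ℕ) : ℝ) * (p : ℝ) ^ (l - r)) * (p : ℝ) ^ (r + t) := by
          gcongr
          exact hexp (r + t) (by
            have := Nat.le_mul_of_pos_right t (show 0 < d - 1 by omega)
            rw [add_mul]; omega)
      _ = ((d - 1 : ℕ) : ℝ) * (p : ℝ) ^ t * (p : ℝ) ^ l := by
          rw [← Nat.sub_add_cancel hrl, Nat.add_sub_cancel]; ring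
      _ ≤ d * d * (p : ℝ) ^ l := by
          gcongr
          omega
      _ = _ := by push_cast; ring

/-- Keeping one integer polynomial and an arbitrary primitive character makes the induction on
coprime factors run: the Chinese remainder theorem changes only the character. Each prime
contributes one factor of the constant. -/
lemma norm_expSum_le {d : ℕ} (hd : 2 ≤ d) (q : ℕ) [NeZero q] {ψ : AddChar (ZMod q) ℂ}
    (hψ : ψ.IsPrimitive) (F : ℤ[X]) (hF : F.natDegree ≤ d)
    (hFq : ∀ p : ℕ, p.Prime → p ∣ q → ∃ j, 1 ≤ j ∧ ¬ (p : ℤ) ∣ F.coeff j) :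
    ‖expSum ψ F‖ * (q : ℝ) ^ (1 / (d : ℝ) ^ 2) ≤
      ((d : ℝ) ^ 2 * d.factorial) ^ q.primeFactors.card * q := by
  have hfac : (1 : ℝ) ≤ d.factorial := by exact_mod_cast d.factorial_pos
  have hd2 : (2 : ℝ) ≤ d := by exact_mod_cast hd
  revert F
  revert ψ
  rename_i hq
  revert hq
  induction q using Nat.recOnPosPrimePosCoprime with
  | zero => intro h; exact absurd rfl h.out
  | one =>
    intro _ ψ _ F _ _
    simpa using norm_expSum_le_card ψ F
  | prime_pow p n hp hn =>
    intro _ ψ hψ F hF hFq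
    have hFp := hFq p hp (dvd_pow_self p (by omega))
    rw [Nat.primeFactors_prime_pow (by omega) hp, Finset.card_singleton, pow_one]
    rcases (by omega : n = 1 ∨ 2 ≤ n) with rfl | hn2
    -- Generalizing the modulus allows the equality `p ^ 1 = p` to be substituted inside the type
    -- `ZMod`.
    · have : ∀ N : ℕ, N = p → ∀ [NeZero N] {ψ : AddChar (ZMod N) ℂ}, ψ.IsPrimitive →
          ‖expSum ψ F‖ * (N : ℝ) ^ (1 / (d : ℝ) ^ 2) ≤ d ^ 2 * d.factorial * N := by
        rintro N rfl _ ψ hψ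
        exact norm_expSum_prime_le hp hd hψ F hF hFp
      exact this _ (pow_one p) hψ
    · refine (norm_expSum_prime_pow_le hp hn2 hd hψ F hF hFp).trans ?_
      gcongr
      nlinarith
  | coprime a b ha hb hab iha ihb =>
    intro _ ψ hψ F hF hFq
    have : NeZero a := ⟨by omega⟩
    have : NeZero b := ⟨by omega⟩
    have hψ' := isPrimitive_equiv (ZMod.chineseRemainder hab) hψ
    have h1 := iha (isPrimitive_inl hψ') F hF
      (fun p hp hpa => hFq p hp (hpa.mul_right b))
    have h2 := ihb (isPrimitive_inr hψ') F hF
      (fun p hp hpb => hFq p hp (hpb.mul_left a))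
    rw [expSum_equiv (ZMod.chineseRemainder hab), expSum_prod, norm_mul,
      hab.primeFactors_mul, Finset.card_union_of_disjoint hab.disjoint_primeFactors, pow_add,
      Nat.cast_mul, Real.mul_rpow (by positivity) (by positivity)]
    calc _ = _ := mul_mul_mul_comm _ _ _ _
      _ ≤ _ := mul_le_mul h1 h2 (by positivity) (by positivity)
      _ = _ := mul_mul_mul_comm _ _ _ _

/-! ### Subpolynomial growth of divisor-type functions. -/

/-- Only the fewer than or equal to `P` primes below `P` lose a factor `K`; the other local factors
are at most the local factor of `q^ε`. -/
lemma prod_primeFactors_le_rpow {ε K : ℝ} (hK : 1 ≤ K) (P : ℕ) (h : ℕ → ℝ) (h0 : ∀ v, 0 ≤ h v)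
    (h1 : ∀ p v : ℕ, 2 ≤ p → h v ≤ K * (p : ℝ) ^ (v * ε))
    (h2 : ∀ p v : ℕ, 2 ≤ p → P ≤ p → 1 ≤ v → h v ≤ (p : ℝ) ^ (v * ε)) (q : ℕ) (hq : q ≠ 0) :
    ∏ p ∈ q.primeFactors, h (q.factorization p) ≤ K ^ P * (q : ℝ) ^ ε := by
  have hqε : (q : ℝ) ^ ε = ∏ p ∈ q.primeFactors, (p : ℝ) ^ (q.factorization p * ε) := by
    conv_lhs => rw [Nat.prod_primeFactors_pow_factorization hq]
    push_cast
    rw [← Real.finsetProd_rpow _ _ (fun _ _ => by positivity)]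
    refine Finset.prod_congr rfl fun p _ => ?_
    rw [← Real.rpow_natCast, ← Real.rpow_mul (by positivity)]
  have hle : ∏ p ∈ q.primeFactors, h (q.factorization p) ≤
      ∏ p ∈ q.primeFactors, ((if p < P then K else 1) * (p : ℝ) ^ (q.factorization p * ε)) := by
    refine Finset.prod_le_prod (fun _ _ => h0 _) fun p hp => ?_
    have hpp := Nat.prime_of_mem_primeFactors hp
    split_ifs with hpP
    · exact h1 p _ hpp.two_le
    · rw [one_mul]
      refine h2 p _ hpp.two_le (not_lt.1 hpP) ?_
      exact hpp.factorization_pos_of_dvd hq (Nat.dvd_of_mem_primeFactors hp)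
  refine hle.trans ?_
  rw [Finset.prod_mul_distrib, ← hqε]
  gcongr
  rw [Finset.prod_ite, Finset.prod_const, Finset.prod_const_one, mul_one]
  refine pow_le_pow_right₀ hK ?_
  calc _ ≤ (Finset.range P).card := Finset.card_le_card fun p hp => by
        simpa using (Finset.mem_filter.1 hp).2
    _ = P := Finset.card_range P

lemma le_natCast_rpow_of_ceil_le {C ε : ℝ} (hC : 0 ≤ C) (hε : 0 < ε) {p : ℕ}
    (hp : ⌈C ^ ε⁻¹⌉₊ ≤ p) : C ≤ (p : ℝ) ^ ε := by
  have h1 : C ^ ε⁻¹ ≤ p := (Nat.le_ceil _).trans (by exact_mod_cast hp)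
  calc C = (C ^ ε⁻¹) ^ ε := by rw [← Real.rpow_mul hC, inv_mul_cancel₀ hε.ne', Real.rpow_one]
    _ ≤ _ := Real.rpow_le_rpow (by positivity) h1 hε.le

lemma exists_pow_card_primeFactors_le {C ε : ℝ} (hC : 1 ≤ C) (hε : 0 < ε) :
    ∃ K : ℝ, 0 < K ∧ ∀ q : ℕ, q ≠ 0 → C ^ q.primeFactors.card ≤ K * (q : ℝ) ^ ε := by
  refine ⟨C ^ ⌈C ^ ε⁻¹⌉₊, by positivity, fun q hq => ?_⟩
  have := prod_primeFactors_le_rpow hC ⌈C ^ ε⁻¹⌉₊ (ε := ε) (fun _ => C) (fun _ => by positivity)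
    (fun p v hp => le_mul_of_one_le_right (by positivity)
      (Real.one_le_rpow (by exact_mod_cast (by omega : 1 ≤ p)) (by positivity)))
    (fun p v hp hpP hv => (le_natCast_rpow_of_ceil_le (by positivity) hε hpP).trans
      (Real.rpow_le_rpow_of_exponent_le (by exact_mod_cast (by omega : 1 ≤ p))
        (le_mul_of_one_le_left hε.le (by exact_mod_cast hv)))) q hq
  simpa using this

lemma exists_card_divisors_le {ε : ℝ} (hε : 0 < ε) :
    ∃ K : ℝ, 0 < K ∧ ∀ q : ℕ, q ≠ 0 → (q.divisors.card : ℝ) ≤ K * (q : ℝ) ^ ε := by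
  have hlog : 0 < Real.log 2 := Real.log_pos one_lt_two
  refine ⟨(1 + (ε * Real.log 2)⁻¹) ^ ⌈(2 : ℝ) ^ ε⁻¹⌉₊, by positivity, fun q hq => ?_⟩
  have := prod_primeFactors_le_rpow (ε := ε) (K := 1 + (ε * Real.log 2)⁻¹)
    (by rw [le_add_iff_nonneg_right]; positivity) ⌈(2 : ℝ) ^ ε⁻¹⌉₊ (fun v => (v : ℝ) + 1)
    (fun v => by positivity) (fun p v hp => ?_) (fun p v hp hpP hv => ?_) q hq
  · rw [Nat.card_divisors hq]
    exact_mod_cast this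
  · calc (v : ℝ) + 1 ≤ (1 + (ε * Real.log 2)⁻¹) * (1 + v * ε * Real.log 2) := by
          have : (1 + (ε * Real.log 2)⁻¹) * (1 + v * ε * Real.log 2) =
            (v + 1) + ((ε * Real.log 2)⁻¹ + v * ε * Real.log 2) := by field_simp; ring
          rw [this, le_add_iff_nonneg_right]
          positivity
      _ ≤ (1 + (ε * Real.log 2)⁻¹) * (2 : ℝ) ^ (v * ε) := by
          gcongr
          rw [Real.rpow_def_of_pos two_pos]
          linarith [Real.add_one_le_exp (Real.log 2 * (v * ε))]
      _ ≤ _ := by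
          gcongr
          exact_mod_cast hp
  · calc (v : ℝ) + 1 ≤ 2 ^ v := by exact_mod_cast Nat.lt_two_pow_self
      _ ≤ ((p : ℝ) ^ ε) ^ v := by
          gcongr
          exact le_natCast_rpow_of_ceil_le (by positivity) hε hpP
      _ = _ := by rw [← Real.rpow_natCast, ← Real.rpow_mul (by positivity), mul_comm]

/-- The Weyl sum estimate for complete sums with any exponent below `1 / d ^ 2`. -/
lemma exists_norm_expSum_le {d : ℕ} (hd : 2 ≤ d) {κ : ℝ} (hκ : κ < 1 / (d : ℝ) ^ 2) :
    ∃ K : ℝ, 0 < K ∧ ∀ (q : ℕ) [NeZero q] (ψ : AddChar (ZMod q) ℂ), ψ.IsPrimitive → ∀ F : ℤ[X],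
      F.natDegree ≤ d →
      (∀ p : ℕ, p.Prime → p ∣ q → ∃ j, 1 ≤ j ∧ ¬ (p : ℤ) ∣ F.coeff j) →
      ‖expSum ψ F‖ ≤ K * (q : ℝ) ^ (-κ) * q := by
  have hfac : (1 : ℝ) ≤ d.factorial := by exact_mod_cast d.factorial_pos
  have hd2 : (2 : ℝ) ≤ d := by exact_mod_cast hd
  obtain ⟨K, hK, hKq⟩ := exists_pow_card_primeFactors_le (C := (d : ℝ) ^ 2 * d.factorial)
    (ε := 1 / (d : ℝ) ^ 2 - κ) (by nlinarith) (by linarith)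
  refine ⟨K, hK, fun q _ ψ hψ F hF hFq => ?_⟩
  have hq0 : (0 : ℝ) < q := by exact_mod_cast Nat.pos_of_ne_zero (NeZero.ne q)
  have h := norm_expSum_le hd q hψ F hF hFq
  have hpos : (0 : ℝ) < (q : ℝ) ^ (1 / (d : ℝ) ^ 2) := by positivity
  rw [← le_div_iff₀ hpos] at h
  refine h.trans ?_
  rw [div_le_iff₀ hpos]
  calc _ ≤ K * (q : ℝ) ^ (1 / (d : ℝ) ^ 2 - κ) * q := by gcongr; exact hKq q (NeZero.ne q)
    _ = _ := by rw [sub_eq_add_neg, Real.rpow_add hq0]; ring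

/-! ### Means of polynomial phases over a period. -/

lemma e_add (s t : ℝ) : e (s + t) = e s * e t := by
  rw [e, e, e, ← Complex.exp_add]
  congr 1
  push_cast
  ring

lemma e_intCast (n : ℤ) : e n = 1 := by
  rw [e, Complex.exp_eq_one_iff]
  exact ⟨n, by push_cast; ring⟩

lemma norm_e (t : ℝ) : ‖e t‖ = 1 := by
  rw [e, show 2 * (Real.pi : ℂ) * t * Complex.I = ((2 * Real.pi * t : ℝ) : ℂ) * Complex.I by
    push_cast; ring, Complex.norm_exp_ofReal_mul_I]

lemma conj_e (t : ℝ) : (starRingEnd ℂ) (e t) = e (-t) := by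
  rw [e, e, ← Complex.exp_conj]
  congr 1
  simp [Complex.conj_ofNat]

lemma e_add_intCast (t : ℝ) (n : ℤ) : e (t + n) = e t := by
  rw [e_add, e_intCast, mul_one]

lemma stdAddChar_intCast (N : ℕ) [NeZero N] (j : ℤ) :
    ZMod.stdAddChar (j : ZMod N) = e ((j : ℝ) / N) := by
  rw [ZMod.stdAddChar_coe, e]
  congr 1
  push_cast
  ring

lemma sum_range_natCast_zmod (D : ℕ) [NeZero D] (f : ZMod D → ℂ) :
    ∑ r ∈ Finset.range D, f (r : ZMod D) = ∑ x : ZMod D, f x :=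
  Finset.sum_bij (fun r _ => (r : ZMod D)) (fun _ _ => Finset.mem_univ _)
    (fun r hr r' hr' h => by
      rw [ZMod.natCast_eq_natCast_iff, Nat.ModEq, Nat.mod_eq_of_lt (Finset.mem_range.1 hr),
        Nat.mod_eq_of_lt (Finset.mem_range.1 hr')] at h
      exact h)
    (fun x _ => ⟨x.val, Finset.mem_range.2 (ZMod.val_lt x), ZMod.natCast_zmod_val x⟩)
    (fun _ _ => rfl)

lemma sum_range_mul_natCast_zmod (D h : ℕ) [NeZero D] (f : ZMod D → ℂ) :
    ∑ r ∈ Finset.range (D * h), f (r : ZMod D) = h * ∑ x : ZMod D, f x := by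
  induction h with
  | zero => simp
  | succ h ih =>
    rw [Nat.mul_succ, Finset.sum_range_add, ih]
    simp only [Nat.cast_add, Nat.cast_mul, CharP.cast_eq_zero, zero_mul, zero_add,
      sum_range_natCast_zmod, Nat.cast_one]
    ring

/-- The sum of `e (F r / N)` over a period is controlled by the reduced modulus of `F / N`. -/
lemma exists_norm_sum_range_e_le {d : ℕ} (hd : 2 ≤ d) {κ : ℝ} (hκ : κ < 1 / (d : ℝ) ^ 2) :
    ∃ K : ℝ, 0 < K ∧ ∀ (N : ℕ) (F : ℤ[X]), N ≠ 0 → F.natDegree ≤ d →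
      ∃ D h : ℕ, N = D * h ∧ (∀ j, 1 ≤ j → (h : ℤ) ∣ F.coeff j) ∧
        ‖∑ r ∈ Finset.range N, e ((F.eval (r : ℤ) : ℤ) / N)‖ ≤ K * (D : ℝ) ^ (-κ) * N := by
  obtain ⟨K, hK, hKq⟩ := exists_norm_expSum_le hd hκ
  refine ⟨K, hK, fun N F hN hF => ?_⟩
  -- The common factor of `N` and the nonconstant coefficients. Cancelling it leaves a polynomial
  -- that is nonconstant modulo every prime dividing `D = N / h`.
  set h : ℕ := Nat.gcd N ((Finset.Icc 1 d).gcd fun j => (F.coeff j).natAbs) with hh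
  have hhF : ∀ j, 1 ≤ j → (h : ℤ) ∣ F.coeff j := by
    intro j hj
    rcases le_or_gt j d with hjd | hjd
    · rw [Int.natCast_dvd]
      exact (Nat.gcd_dvd_right _ _).trans (Finset.gcd_dvd (Finset.mem_Icc.2 ⟨hj, hjd⟩))
    · rw [coeff_eq_zero_of_natDegree_lt (by omega)]; exact dvd_zero _
  have hhpos : 0 < h := Nat.gcd_pos_of_pos_left _ (Nat.pos_of_ne_zero hN)
  obtain ⟨D, hD⟩ : h ∣ N := Nat.gcd_dvd_left _ _
  have hD0 : D ≠ 0 := by rintro rfl; exact hN (by simpa using hD)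
  have : NeZero D := ⟨hD0⟩
  refine ⟨D, h, by rw [hD, mul_comm], hhF, ?_⟩
  obtain ⟨F₁, hF₁⟩ : C (h : ℤ) ∣ F - C (F.coeff 0) := by
    rw [C_dvd_iff_dvd_coeff]
    intro j
    rcases Nat.eq_zero_or_pos j with rfl | hj
    · simp
    · rw [coeff_sub, coeff_C_of_ne_zero hj.ne', sub_zero]; exact hhF j hj
  have hFeq : F = C (F.coeff 0) + C (h : ℤ) * F₁ := by rw [← hF₁]; ring
  have hcoeff : ∀ j, 1 ≤ j → F.coeff j = h * F₁.coeff j := by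
    intro j hj
    conv_lhs => rw [hFeq]
    rw [coeff_add, coeff_C_of_ne_zero (by omega), zero_add, coeff_C_mul]
  have hF₁deg : F₁.natDegree ≤ d := by
    rw [natDegree_le_iff_coeff_eq_zero]
    intro j hj
    have := hcoeff j (by omega)
    rw [coeff_eq_zero_of_natDegree_lt (by omega)] at this
    exact (mul_eq_zero.1 this.symm).resolve_left (by exact_mod_cast hhpos.ne')
  have hprim : ∀ p : ℕ, p.Prime → p ∣ D → ∃ j, 1 ≤ j ∧ ¬ (p : ℤ) ∣ F₁.coeff j := by
    intro p hp hpD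
    by_contra! hcon
    have h1 : h * p ∣ h := by
      conv_rhs => rw [hh]
      refine Nat.dvd_gcd (by rw [hD]; exact Nat.mul_dvd_mul_left h hpD) (Finset.dvd_gcd ?_)
      intro j hj
      rw [← Int.natCast_dvd, hcoeff j (Finset.mem_Icc.1 hj).1]
      push_cast
      exact mul_dvd_mul_left _ (hcon j (Finset.mem_Icc.1 hj).1)
    have h2 := Nat.le_of_dvd hhpos h1
    have := hp.two_le
    nlinarith
  have hNR : (N : ℝ) = h * D := by exact_mod_cast hD
  have hsum : ∑ r ∈ Finset.range N, e ((F.eval (r : ℤ) : ℤ) / N) =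
      e ((F.coeff 0 : ℤ) / N) * (h * expSum (ZMod.stdAddChar (N := D)) F₁) := by
    rw [expSum, ← sum_range_mul_natCast_zmod, mul_comm D h, ← hD, Finset.mul_sum]
    refine Finset.sum_congr rfl fun r _ => ?_
    have h1 := eval₂_castRingHom_intCast (R := ZMod D) F₁ r
    push_cast at h1
    rw [h1, stdAddChar_intCast, ← e_add]
    congr 1
    conv_lhs => rw [hFeq]
    have hDR : (D : ℝ) ≠ 0 := by exact_mod_cast hD0
    have hhR : (h : ℝ) ≠ 0 := by exact_mod_cast hhpos.ne'
    simp only [eval_add, eval_mul, eval_C, hNR]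
    push_cast
    field_simp
  rw [hsum, norm_mul, norm_e, one_mul, norm_mul, Complex.norm_natCast]
  calc _ ≤ (h : ℝ) * (K * (D : ℝ) ^ (-κ) * D) := by
        gcongr
        exact hKq D _ (ZMod.isPrimitive_stdAddChar D) F₁ hF₁deg hprim
    _ = _ := by rw [hNR]; ring

/-- The decay must not depend on `a/q`, which varies with `x` in the linearized operator. The
coefficient of degree `d - 1` involves only `a'/q'` and `u`, and it forces `q' / gcd(q', u)` to
divide `D d`. -/
lemma exists_norm_sum_range_e_sub_le {d : ℕ} (hd : 2 ≤ d) {κ : ℝ} (hκ0 : 0 ≤ κ)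
    (hκ : κ < 1 / (d : ℝ) ^ 2) :
    ∃ K : ℝ, 0 < K ∧ ∀ (a q a' q' : ℕ) (u : ℤ), q ≠ 0 → q' ≠ 0 → a'.Coprime q' →
      ‖∑ r ∈ Finset.range (q * q'), e ((a : ℝ) / q * (r : ℝ) ^ d -
        (a' : ℝ) / q' * ((r : ℝ) + u) ^ d)‖ ≤
      K * ((q' / Int.gcd q' u : ℕ) : ℝ) ^ (-κ) * (q * q') := by
  obtain ⟨K, hK, hKN⟩ := exists_norm_sum_range_e_le hd hκ
  have hdpos : (0 : ℝ) < d := by exact_mod_cast (by omega : 0 < d)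
  refine ⟨K * (d : ℝ) ^ κ, by positivity, fun a q a' q' u hq hq' hcop => ?_⟩
  set F : ℤ[X] := C (a * q' : ℤ) * X ^ d - C (a' * q : ℤ) * (X + C u) ^ d with hF
  have hFdeg : F.natDegree ≤ d := by
    refine (natDegree_sub_le _ _).trans (max_le ?_ ?_)
    · exact natDegree_C_mul_X_pow_le _ _
    · refine (natDegree_C_mul_le _ _).trans ?_
      rw [natDegree_pow, natDegree_X_add_C, mul_one]
  obtain ⟨D, h, hDh, hcoeff, hbound⟩ := hKN (q * q') F (mul_ne_zero hq hq') hFdeg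
  have hDpos : 0 < D := Nat.pos_of_ne_zero (by rintro rfl; simp_all)
  have hsum : ∑ r ∈ Finset.range (q * q'), e ((a : ℝ) / q * (r : ℝ) ^ d -
        (a' : ℝ) / q' * ((r : ℝ) + u) ^ d) =
      ∑ r ∈ Finset.range (q * q'), e ((F.eval (r : ℤ) : ℤ) / (q * q' : ℕ)) := by
    refine Finset.sum_congr rfl fun r _ => ?_
    congr 1
    have hqR : (q : ℝ) ≠ 0 := by exact_mod_cast hq
    have hqR' : (q' : ℝ) ≠ 0 := by exact_mod_cast hq'
    simp only [hF, eval_sub, eval_mul, eval_C, eval_pow, eval_X, eval_add]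
    push_cast
    field_simp
  rw [hsum]
  refine hbound.trans ?_
  have hgpos : 0 < Int.gcd q' u := Int.gcd_pos_of_ne_zero_left _ (by exact_mod_cast hq')
  have hdiv : q' / Int.gcd q' u ∣ D * d := by
    -- `d ≥ 2` makes `d - 1` a nonconstant degree. The term `X^d` does not contribute to it.
    have h1 : (h : ℤ) ∣ a' * q * (u * d) := by
      have := hcoeff (d - 1) (by omega)
      rw [hF, coeff_sub, coeff_C_mul, coeff_X_pow, if_neg (by omega), mul_zero, zero_sub,
        coeff_C_mul, coeff_X_add_C_pow, dvd_neg, show d - (d - 1) = 1 by omega, pow_one,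
        Nat.choose_symm (by omega : 1 ≤ d), Nat.choose_one_right] at this
      exact this
    have h2 : (q' : ℤ) ∣ a' * (D * d * u) := by
      have h3 : (q : ℤ) * q' ∣ q * (a' * (D * d * u)) := by
        rw [show (q : ℤ) * q' = D * h by exact_mod_cast hDh,
          show (q : ℤ) * (a' * (D * d * u)) = D * (a' * q * (u * d)) by ring]
        exact mul_dvd_mul_left _ h1
      exact Int.dvd_of_mul_dvd_mul_left (by exact_mod_cast hq) h3
    have h4 : (q' : ℤ) ∣ D * d * u :=
      (Int.isCoprime_iff_gcd_eq_one.2 (by simpa [Int.gcd_natCast_natCast] using hcop.symm)).dvd_of_dvd_mul_left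
        h2
    have h5 : q' ∣ (D * d) * u.natAbs := by
      have := Int.natAbs_dvd_natAbs.2 h4
      simpa [Int.natAbs_mul] using this
    have h6 : Int.gcd q' u = Nat.gcd q' u.natAbs := rfl
    rw [h6] at hgpos ⊢
    refine (Nat.coprime_div_gcd_div_gcd hgpos).dvd_of_dvd_mul_right
      (k := q' / _) (n := u.natAbs / _) ?_
    rw [← Nat.mul_div_assoc _ (Nat.gcd_dvd_right _ _)]
    exact Nat.div_dvd_div (Nat.gcd_dvd_left _ _) h5
  have hle : ((q' / Int.gcd q' u : ℕ) : ℝ) ≤ D * d := by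
    exact_mod_cast Nat.le_of_dvd (by positivity) hdiv
  have hq'g : 0 < q' / Int.gcd q' u :=
    Nat.div_pos (Nat.le_of_dvd (Nat.pos_of_ne_zero hq') (by exact_mod_cast Int.gcd_dvd_left (q' : ℤ) u)) hgpos
  have hkey : (D : ℝ) ^ (-κ) ≤ (d : ℝ) ^ κ * ((q' / Int.gcd q' u : ℕ) : ℝ) ^ (-κ) := by
    calc (D : ℝ) ^ (-κ) = (d : ℝ) ^ κ * ((D : ℝ) * d) ^ (-κ) := by
          rw [Real.mul_rpow (by positivity) (by positivity), mul_comm ((D : ℝ) ^ (-κ)), ← mul_assoc,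
            ← Real.rpow_add hdpos, add_neg_cancel, Real.rpow_zero, one_mul]
      _ ≤ _ := by
          refine mul_le_mul_of_nonneg_left ?_ (by positivity)
          exact Real.rpow_le_rpow_of_nonpos (by exact_mod_cast hq'g) hle (neg_nonpos.2 hκ0)
  calc K * (D : ℝ) ^ (-κ) * ((q * q' : ℕ) : ℝ)
      ≤ K * ((d : ℝ) ^ κ * ((q' / Int.gcd q' u : ℕ) : ℝ) ^ (-κ)) * ((q * q' : ℕ) : ℝ) := by gcongr
    _ = _ := by push_cast; ring

/-! ### Summation of the Weyl sums over the numerators `b`. -/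

lemma sum_Icc_natCast_zmod (q : ℕ) [NeZero q] (f : ZMod q → ℂ) :
    ∑ r ∈ Finset.Icc 1 q, f (r : ZMod q) = ∑ x : ZMod q, f x := by
  rw [← Finset.Ico_succ_right_eq_Icc, Finset.sum_Ico_eq_sum_range, Nat.succ_eq_succ, Nat.succ_sub_one,
    ← Equiv.sum_comp (Equiv.addLeft (1 : ZMod q)) f,
    ← sum_range_natCast_zmod q (fun x => f (Equiv.addLeft 1 x))]
  simp

lemma weylSum_eq_sum_zmod (d a b q : ℕ) [NeZero q] :
    weylSum d a b q = (1 / (q : ℂ)) * ∑ x : ZMod q, ZMod.stdAddChar (-(a * x ^ d) - b * x : ZMod q) := by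
  rw [weylSum, ← sum_Icc_natCast_zmod]
  congr 1
  refine Finset.sum_congr rfl fun r _ => ?_
  have h := stdAddChar_intCast q (-(a * (r : ℤ) ^ d) - b * r)
  push_cast at h
  rw [h]
  congr 1
  ring

/-- Translate `x` by `q / gcd(a, q)`. The term `a x^d` is unchanged modulo `q`, while the linear
term multiplies the sum by a constant different from 1, since `gcd(a, q)` does not divide `b`. -/
lemma weylSum_eq_zero {d a b q : ℕ} (hq : q ≠ 0) (haq : ¬ a.Coprime q)
    (hb : Nat.gcd a (Nat.gcd b q) = 1) : weylSum d a b q = 0 := by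
  have : NeZero q := ⟨hq⟩
  set h := Nat.gcd a q with hh
  have hpos : 0 < h := Nat.gcd_pos_of_pos_right _ (Nat.pos_of_ne_zero hq)
  obtain ⟨q₁, hq₁⟩ : h ∣ q := Nat.gcd_dvd_right _ _
  obtain ⟨a₁, ha₁⟩ : h ∣ a := Nat.gcd_dvd_left _ _
  set t : ZMod q := (q₁ : ZMod q) with ht
  have hat : (a : ZMod q) * t = 0 := by
    rw [ht, ← Nat.cast_mul, ZMod.natCast_eq_zero_iff, ha₁]
    exact ⟨a₁, by
      calc h * a₁ * q₁ = (h * q₁) * a₁ := by ring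
        _ = q * a₁ := by rw [← hq₁]⟩
  have hbt : (b : ZMod q) * t ≠ 0 := by
    rw [ht, ← Nat.cast_mul, Ne, ZMod.natCast_eq_zero_iff]
    intro hdvd
    have hq₁0 : 0 < q₁ := Nat.pos_of_ne_zero (by rintro rfl; exact hq (by simpa using hq₁))
    have h1 : h ∣ b := by
      apply Nat.dvd_of_mul_dvd_mul_right hq₁0
      rw [← hq₁]; exact hdvd
    have h2 : h ∣ 1 := by
      rw [← hb]
      exact Nat.dvd_gcd ⟨a₁, ha₁⟩ (Nat.dvd_gcd h1 ⟨q₁, hq₁⟩)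
    exact haq (Nat.dvd_one.1 h2)
  set S := ∑ x : ZMod q, (ZMod.stdAddChar (-(a * x ^ d) - b * x : ZMod q) : ℂ) with hS
  have hshift : S = S * ZMod.stdAddChar (-(b * t) : ZMod q) := by
    conv_lhs => rw [hS, ← Equiv.sum_comp (Equiv.addRight t)]
    rw [hS, Finset.sum_mul]
    refine Finset.sum_congr rfl fun x _ => ?_
    rw [← AddChar.map_add_eq_mul, Equiv.coe_addRight]
    congr 1
    obtain ⟨c, hc⟩ := sub_dvd_pow_sub_pow (x + t) x d
    rw [add_sub_cancel_left] at hc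
    have : (a : ZMod q) * (x + t) ^ d = a * x ^ d := by
      rw [← sub_eq_zero, ← mul_sub, hc, ← mul_assoc, hat, zero_mul]
    rw [this]
    ring
  have hne : (ZMod.stdAddChar (-(b * t) : ZMod q) : ℂ) ≠ 1 := by
    rw [← AddChar.map_zero_eq_one (ZMod.stdAddChar (N := q))]
    intro heq
    exact hbt (neg_eq_zero.1 (ZMod.injective_stdAddChar heq))
  rw [weylSum_eq_sum_zmod, ← hS]
  have : S * (ZMod.stdAddChar (-(b * t) : ZMod q) - 1) = 0 := by rw [mul_sub, ← hshift]; ring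
  rw [(mul_eq_zero.1 this).resolve_right (sub_ne_zero.2 hne), mul_zero]

/-- Fourier inversion on `ℤ/q`: as a function of `b`, the Weyl sum is the transform of `x ↦ e(-(a/q)
x^d)`. -/
lemma sum_Icc_weylSum_mul_e (d a q : ℕ) (hq : q ≠ 0) (m : ℤ) :
    ∑ b ∈ Finset.Icc 1 q, weylSum d a b q * e ((b : ℝ) / q * m) = e (-((a : ℝ) / q * (m : ℝ) ^ d)) := by
  have : NeZero q := ⟨hq⟩
  have hqC : (q : ℂ) ≠ 0 := by exact_mod_cast hq
  have hb : ∀ b : ℕ, e ((b : ℝ) / q * m) = ZMod.stdAddChar ((b : ZMod q) * (m : ZMod q)) := by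
    intro b
    have h := stdAddChar_intCast q (b * m)
    push_cast at h
    rw [h]
    congr 1
    ring
  have hm : e (-((a : ℝ) / q * (m : ℝ) ^ d)) = ZMod.stdAddChar (-(a * (m : ZMod q) ^ d) : ZMod q) := by
    have h := stdAddChar_intCast q (-(a * m ^ d))
    push_cast at h
    rw [h]
    congr 1
    ring
  simp_rw [hb, weylSum_eq_sum_zmod, hm]
  rw [sum_Icc_natCast_zmod q (fun b => 1 / (q : ℂ) *
    (∑ x : ZMod q, ZMod.stdAddChar (-(a * x ^ d) - b * x : ZMod q)) * ZMod.stdAddChar (b * (m : ZMod q)))]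
  have h1 : ∀ b : ZMod q, 1 / (q : ℂ) * (∑ x : ZMod q, ZMod.stdAddChar (-(a * x ^ d) - b * x : ZMod q)) *
      ZMod.stdAddChar (b * (m : ZMod q)) = ∑ x : ZMod q, 1 / (q : ℂ) *
        (ZMod.stdAddChar (-(a * x ^ d) : ZMod q) * ZMod.stdAddChar (b * (m - x) : ZMod q)) := by
    intro b
    rw [mul_assoc, Finset.sum_mul, Finset.mul_sum]
    refine Finset.sum_congr rfl fun x _ => ?_
    rw [← AddChar.map_add_eq_mul, ← AddChar.map_add_eq_mul]
    congr 2
    ring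
  simp_rw [h1]
  rw [Finset.sum_comm]
  simp_rw [← Finset.mul_sum, AddChar.sum_mulShift _ (ZMod.isPrimitive_stdAddChar q), sub_eq_zero]
  simp [hqC, mul_comm]

lemma sum_numerators_weylSum_mul_e {d s a q : ℕ} (hs : 2 ^ (s - 1) ≤ q ∧ q < 2 ^ s) (m : ℤ) :
    ∑ b ∈ numerators s a q, weylSum d a b q * e ((b : ℝ) / q * m) =
      if a.Coprime q then e (-((a : ℝ) / q * (m : ℝ) ^ d)) else 0 := by
  have hq : q ≠ 0 := (lt_of_lt_of_le (by positivity) hs.1).ne'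
  split_ifs with h
  · rw [← sum_Icc_weylSum_mul_e d a q hq, numerators, Finset.filter_true_of_mem]
    intro b _
    refine ⟨?_, hs⟩
    exact Nat.dvd_one.1 (h ▸ Nat.gcd_dvd_gcd_of_dvd_right a (Nat.gcd_dvd_right b q))
  · refine Finset.sum_eq_zero fun b hb => ?_
    rw [weylSum_eq_zero hq h (Finset.mem_filter.1 hb).2.1, zero_mul]

/-! ### The multiplier as a convolution operator. -/

/-- The inverse Fourier transform of the bump `φ`, at integers. -/
noncomputable def bumpKernel (φ : ℝ → ℝ) (m : ℤ) : ℂ := ∫ ξ : ℝ, (φ ξ : ℂ) * e (ξ * m)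

@[fun_prop]
lemma continuous_e : Continuous e := by
  unfold e
  fun_prop

namespace IsAdaptedBump

variable {A δ : ℝ} {φ : ℝ → ℝ}

lemma continuous (h : IsAdaptedBump A δ φ) : Continuous φ := h.smooth.continuous

lemma integrable_mul (h : IsAdaptedBump A δ φ) (c : ℝ) {g : ℝ → ℂ} (hg : Continuous g) :
    Integrable fun ξ => (φ (ξ - c) : ℂ) * g ξ := by
  refine Continuous.integrable_of_hasCompactSupport
    ((Complex.continuous_ofReal.comp (h.continuous.comp (by fun_prop))).mul hg) ?_
  refine HasCompactSupport.intro (isCompact_Icc (a := c - δ) (b := c + δ)) fun ξ hξ => ?_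
  rw [h.support, Complex.ofReal_zero, zero_mul]
  by_contra! hcon
  rw [abs_le] at hcon
  exact hξ ⟨by linarith, by linarith⟩

lemma integral_periodize (h : IsAdaptedBump A δ φ) (hδ : δ ≤ 1) {c : ℝ} (hc0 : 0 ≤ c) (hc1 : c ≤ 1)
    (m : ℤ) : ∫ β in (0 : ℝ)..1, (periodize φ (β - c) : ℂ) * e (β * m) =
      e (c * m) * bumpKernel φ m := by
  set f : ℝ → ℂ := fun ξ => (φ (ξ - c) : ℂ) * e (ξ * m) with hf
  have hfint : Integrable f := h.integrable_mul c (by fun_prop)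
  have hfcont : Continuous f :=
    (Complex.continuous_ofReal.comp (h.continuous.comp (by fun_prop))).mul (by fun_prop)
  -- For `β` and `c` in `[0, 1]` and `|n| ≥ 3`, the point `β - c + n` has modulus at least `2 > δ`.
  -- The periodization is thus a finite sum, and the integral unfolds to the line.
  set I : Finset ℤ := Finset.Icc (-2) 2 with hI
  have hzero : ∀ n : ℤ, n ∉ I → ∀ β : ℝ, 0 ≤ β → β ≤ 1 → φ (β - c + n) = 0 := by
    intro n hn β hβ0 hβ1
    apply h.support
    rw [hI, Finset.mem_Icc, not_and_or, not_le, not_le] at hn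
    rw [lt_abs]
    rcases hn with hn | hn
    · right
      have : (n : ℝ) ≤ -3 := by exact_mod_cast (by omega : n ≤ -3)
      linarith
    · left
      have : (3 : ℝ) ≤ n := by exact_mod_cast (by omega : 3 ≤ n)
      linarith
  have hfn : ∀ (n : ℤ) (β : ℝ), f (β + n) = (φ (β - c + n) : ℂ) * e (β * m) := by
    intro n β
    simp only [hf]
    rw [add_mul, ← Int.cast_mul, e_add_intCast, add_sub_right_comm]
  have hper : ∀ β ∈ Set.uIcc (0 : ℝ) 1, (periodize φ (β - c) : ℂ) * e (β * m) =
      ∑ n ∈ I, f (β + n) := by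
    intro β hβ
    rw [Set.uIcc_of_le zero_le_one] at hβ
    have hp : periodize φ (β - c) = ∑ n ∈ I, φ (β - c + n) := by
      rw [periodize, ← (Equiv.neg ℤ).tsum_eq]
      simp only [Equiv.neg_apply, Int.cast_neg, sub_neg_eq_add]
      exact tsum_eq_sum fun n hn => hzero n hn β hβ.1 hβ.2
    rw [hp]
    simp_rw [hfn]
    push_cast
    rw [Finset.sum_mul]
  rw [intervalIntegral.integral_congr hper, intervalIntegral.integral_finsetSum
    (fun n _ => Continuous.intervalIntegrable (by fun_prop) _ _)]
  have hsum := hfint.hasSum_intervalIntegral_comp_add_int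
  have hsum' : HasSum (fun n : ℤ => ∫ x in (0 : ℝ)..1, f (x + n))
      (∑ n ∈ I, ∫ x in (0 : ℝ)..1, f (x + n)) := by
    refine hasSum_sum_of_ne_finset_zero fun n hn => ?_
    rw [intervalIntegral.integral_congr (g := fun _ => 0), intervalIntegral.integral_zero]
    intro β hβ
    rw [Set.uIcc_of_le zero_le_one] at hβ
    simp only
    rw [hfn, hzero n hn β hβ.1 hβ.2, Complex.ofReal_zero, zero_mul]
  rw [hsum'.unique hsum, ← integral_add_right_eq_self f c, bumpKernel, ← integral_const_mul]
  refine integral_congr_ae (Filter.Eventually.of_forall fun ξ => ?_)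
  simp only [hf, add_sub_cancel_right]
  rw [add_mul, e_add]
  ring

lemma continuous_periodize (h : IsAdaptedBump A δ φ) (hδ : δ ≤ 1) : Continuous (periodize φ) := by
  refine continuous_iff_continuousAt.2 fun x₀ => ?_
  set I : Finset ℤ := Finset.Icc (⌊x₀⌋ - 4) (⌊x₀⌋ + 4) with hI
  have hev : (fun β => ∑ l ∈ I, φ (β - l)) =ᶠ[nhds x₀] periodize φ := by
    filter_upwards [Ioo_mem_nhds (show x₀ - 1 < x₀ by linarith) (show x₀ < x₀ + 1 by linarith)]
      with β hβ
    refine (tsum_eq_sum fun l hl => h.support _ ?_).symm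
    rw [hI, Finset.mem_Icc, not_and_or, not_le, not_le] at hl
    have h1 := Int.floor_le x₀
    have h2 := Int.lt_floor_add_one x₀
    rw [lt_abs]
    rcases hl with hl | hl
    · left
      have : (l : ℝ) ≤ ⌊x₀⌋ - 5 := by exact_mod_cast (by omega : l ≤ ⌊x₀⌋ - 5)
      linarith [hβ.1]
    · right
      have : (⌊x₀⌋ : ℝ) + 5 ≤ l := by exact_mod_cast (by omega : ⌊x₀⌋ + 5 ≤ l)
      linarith [hβ.2]
  refine ContinuousAt.congr ?_ hev
  exact (continuous_finsetSum _ fun l _ => h.continuous.comp (by fun_prop)).continuousAt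

lemma invFourierZ_eq (h : IsAdaptedBump A δ φ) (hδ : δ ≤ 1) {c : ℝ} (hc0 : 0 ≤ c) (hc1 : c ≤ 1)
    (f : ℤ →₀ ℂ) (x : ℤ) :
    invFourierZ (fun β => (periodize φ (β - c) : ℂ) * fourierZ f β) x =
      ∑ n ∈ f.support, f n * (e (c * ((x - n : ℤ) : ℝ)) * bumpKernel φ (x - n)) := by
  have hcont := h.continuous_periodize hδ
  have h1 : ∀ β : ℝ, (periodize φ (β - c) : ℂ) * fourierZ f β * e (β * x) =
      ∑ n ∈ f.support, f n * ((periodize φ (β - c) : ℂ) * e (β * ((x - n : ℤ) : ℝ))) := by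
    intro β
    rw [fourierZ, Finset.mul_sum, Finset.sum_mul]
    refine Finset.sum_congr rfl fun n _ => ?_
    rw [show β * ((x - n : ℤ) : ℝ) = -(β * n) + β * x by push_cast; ring, e_add]
    ring
  rw [invFourierZ]
  simp_rw [h1]
  rw [intervalIntegral.integral_finsetSum]
  · refine Finset.sum_congr rfl fun n _ => ?_
    rw [intervalIntegral.integral_const_mul, h.integral_periodize hδ hc0 hc1]
  · intro n _
    refine Continuous.intervalIntegrable ?_ _ _
    refine continuous_const.mul (.mul (Complex.continuous_ofReal.comp (hcont.comp ?_)) ?_) <;>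
      fun_prop

lemma weylMultiplier_eq (h : IsAdaptedBump A δ φ) (hδ : δ ≤ 1) {d s a q : ℕ}
    (hs : 2 ^ (s - 1) ≤ q ∧ q < 2 ^ s) (f : ℤ →₀ ℂ) (x : ℤ) :
    weylMultiplier d s a q φ f x = if a.Coprime q then ∑ n ∈ f.support, f n *
      (e (-((a : ℝ) / q * ((x - n : ℤ) : ℝ) ^ d)) * bumpKernel φ (x - n)) else 0 := by
  have hb : ∀ b ∈ numerators s a q, (0 : ℝ) ≤ (b : ℝ) / q ∧ (b : ℝ) / q ≤ 1 := by
    intro b hb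
    refine ⟨by positivity, div_le_one_of_le₀ ?_ (by positivity)⟩
    exact_mod_cast (Finset.mem_Icc.1 (Finset.mem_filter.1 hb).1).2
  rw [weylMultiplier, Finset.sum_congr rfl fun b hbm => by
    rw [h.invFourierZ_eq hδ (hb b hbm).1 (hb b hbm).2, Finset.mul_sum], Finset.sum_comm]
  have h1 : ∀ n : ℤ, ∑ b ∈ numerators s a q, weylSum d a b q *
      (f n * (e ((b : ℝ) / q * ((x - n : ℤ) : ℝ)) * bumpKernel φ (x - n))) =
      f n * ((if a.Coprime q then e (-((a : ℝ) / q * ((x - n : ℤ) : ℝ) ^ d)) else 0) *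
        bumpKernel φ (x - n)) := by
    intro n
    rw [← sum_numerators_weylSum_mul_e hs, Finset.sum_mul, Finset.mul_sum]
    refine Finset.sum_congr rfl fun b _ => ?_
    ring
  simp_rw [h1]
  split_ifs <;> simp

end IsAdaptedBump

lemma weylMultiplier_eq_zero {d s a q : ℕ} {φ : ℝ → ℝ}
    (hs : ¬ (2 ^ (s - 1) ≤ q ∧ q < 2 ^ s)) (f : ℤ →₀ ℂ) (x : ℤ) :
    weylMultiplier d s a q φ f x = 0 := by
  rw [weylMultiplier, numerators, Finset.filter_false_of_mem, Finset.sum_empty]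
  exact fun b _ h => hs h.2

/-! ### Decay and slow variation of the bump kernel. -/

lemma hasDerivAt_e_mul (y ξ : ℝ) :
    HasDerivAt (fun ξ : ℝ => e (ξ * y)) (2 * Real.pi * y * Complex.I * e (ξ * y)) ξ := by
  have h1 : HasDerivAt (fun ξ : ℝ => ((2 * Real.pi * y * ξ : ℝ) : ℂ) * Complex.I)
      (((2 * Real.pi * y : ℝ) : ℂ) * Complex.I) ξ := by
    have := ((hasDerivAt_id ξ).const_mul (2 * Real.pi * y)).ofReal_comp
    simpa using this.mul_const Complex.I
  have h2 := h1.cexp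
  have h3 : (fun ξ : ℝ => e (ξ * y)) =
      fun ξ : ℝ => Complex.exp (((2 * Real.pi * y * ξ : ℝ) : ℂ) * Complex.I) := by
    ext ξ
    rw [e]
    congr 1
    push_cast
    ring
  rw [h3]
  convert h2 using 1
  rw [e]
  push_cast
  rw [mul_comm]
  congr 2
  ring

lemma norm_integral_le_of_support {g : ℝ → ℂ} {δ M : ℝ} (hδ : 0 ≤ δ)
    (hsupp : ∀ ξ, δ < |ξ| → g ξ = 0) (hM : ∀ ξ, |ξ| ≤ δ → ‖g ξ‖ ≤ M) :
    ‖∫ ξ, g ξ‖ ≤ 2 * δ * M := by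
  have h1 : ∫ ξ, g ξ = ∫ ξ in Set.Icc (-δ) δ, g ξ := by
    refine (setIntegral_eq_integral_of_forall_compl_eq_zero fun ξ hξ => hsupp ξ ?_).symm
    by_contra! h
    exact hξ (abs_le.1 h)
  rw [h1]
  refine (norm_setIntegral_le_of_norm_le_const (s := Set.Icc (-δ) δ) (C := M) (by simp)
    fun ξ hξ => hM ξ (abs_le.2 hξ)).trans (le_of_eq ?_)
  rw [measureReal_def, Real.volume_Icc, ENNReal.toReal_ofReal (by linarith)]
  ring

lemma integrable_of_support {g : ℝ → ℂ} {δ : ℝ} (hg : Continuous g)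
    (hsupp : ∀ ξ, δ < |ξ| → g ξ = 0) : Integrable g := by
  refine hg.integrable_of_hasCompactSupport
    (HasCompactSupport.intro (isCompact_Icc (a := -δ) (b := δ)) fun ξ hξ => hsupp ξ ?_)
  by_contra! h
  exact hξ (abs_le.1 h)

lemma integral_mul_e_deriv {g g' : ℝ → ℂ} {δ : ℝ} (hg : ∀ ξ, HasDerivAt g (g' ξ) ξ)
    (hg' : Continuous g') (hsupp : ∀ ξ, δ < |ξ| → g ξ = 0) (hsupp' : ∀ ξ, δ < |ξ| → g' ξ = 0)
    (y : ℝ) : 2 * Real.pi * y * Complex.I * ∫ ξ, g ξ * e (ξ * y) = -∫ ξ, g' ξ * e (ξ * y) := by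
  have hgc : Continuous g := continuous_iff_continuousAt.2 fun ξ => (hg ξ).continuousAt
  have h := integral_mul_deriv_eq_deriv_mul_of_integrable (u := g) (u' := g')
    (v := fun ξ : ℝ => e (ξ * y)) (v' := fun ξ : ℝ => 2 * Real.pi * y * Complex.I * e (ξ * y))
    (fun ξ _ => hg ξ) (fun ξ _ => hasDerivAt_e_mul y ξ)
    (integrable_of_support (δ := δ) (by fun_prop) fun ξ hξ => by simp [hsupp ξ hξ])
    (integrable_of_support (δ := δ) (by fun_prop) fun ξ hξ => by simp [hsupp' ξ hξ])
    (integrable_of_support (δ := δ) (by fun_prop) fun ξ hξ => by simp [hsupp ξ hξ])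
  rw [← h, ← integral_const_mul]
  refine integral_congr_ae (Filter.Eventually.of_forall fun ξ => ?_)
  ring

/-- Decay of the Fourier transform of a compactly supported `C²` function. -/
lemma norm_integral_mul_e_le {g g' g'' : ℝ → ℂ} {δ A₀ A₂ : ℝ} (hδ : 0 ≤ δ)
    (hg : ∀ ξ, HasDerivAt g (g' ξ) ξ) (hg' : ∀ ξ, HasDerivAt g' (g'' ξ) ξ) (hg'' : Continuous g'')
    (hsupp : ∀ ξ, δ < |ξ| → g ξ = 0) (hsupp' : ∀ ξ, δ < |ξ| → g' ξ = 0)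
    (hsupp'' : ∀ ξ, δ < |ξ| → g'' ξ = 0) (hA₀ : ∀ ξ, |ξ| ≤ δ → ‖g ξ‖ ≤ A₀)
    (hA₂ : ∀ ξ, |ξ| ≤ δ → ‖g'' ξ‖ ≤ A₂) (y : ℝ) :
    ‖∫ ξ, g ξ * e (ξ * y)‖ * (1 + δ * |y|) ^ 2 ≤ 4 * δ * (A₀ + δ ^ 2 * A₂) := by
  have hgc' : Continuous g' := continuous_iff_continuousAt.2 fun ξ => (hg' ξ).continuousAt
  have h0 : ‖∫ ξ, g ξ * e (ξ * y)‖ ≤ 2 * δ * A₀ := by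
    refine norm_integral_le_of_support hδ (fun ξ hξ => by rw [hsupp ξ hξ, zero_mul]) fun ξ hξ => ?_
    rw [norm_mul, norm_e, mul_one]
    exact hA₀ ξ hξ
  have h2 : ‖∫ ξ, g'' ξ * e (ξ * y)‖ ≤ 2 * δ * A₂ := by
    refine norm_integral_le_of_support hδ (fun ξ hξ => by rw [hsupp'' ξ hξ, zero_mul]) fun ξ hξ => ?_
    rw [norm_mul, norm_e, mul_one]
    exact hA₂ ξ hξ
  have hnorm : ‖2 * (Real.pi : ℂ) * y * Complex.I‖ = 2 * Real.pi * |y| := by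
    simp [abs_of_pos Real.pi_pos]
  -- Two integrations by parts.
  have h3 : (2 * Real.pi * |y|) ^ 2 * ‖∫ ξ, g ξ * e (ξ * y)‖ = ‖∫ ξ, g'' ξ * e (ξ * y)‖ := by
    rw [← hnorm, pow_two, mul_assoc, ← norm_mul, integral_mul_e_deriv hg hgc' hsupp hsupp', norm_neg,
      ← norm_mul, integral_mul_e_deriv hg' hg'' hsupp' hsupp'', norm_neg]
  have h4 : |y| ^ 2 * ‖∫ ξ, g ξ * e (ξ * y)‖ ≤ 2 * δ * A₂ := by
    refine le_trans ?_ (h3.trans_le h2)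
    gcongr
    nlinarith [Real.pi_gt_three, abs_nonneg y]
  have h5 : (1 + δ * |y|) ^ 2 ≤ 2 * (1 + δ ^ 2 * |y| ^ 2) := by
    nlinarith [sq_nonneg (1 - δ * |y|)]
  calc _ ≤ ‖∫ ξ, g ξ * e (ξ * y)‖ * (2 * (1 + δ ^ 2 * |y| ^ 2)) := by gcongr
    _ = 2 * (‖∫ ξ, g ξ * e (ξ * y)‖ + δ ^ 2 * (|y| ^ 2 * ‖∫ ξ, g ξ * e (ξ * y)‖)) := by ring
    _ ≤ 2 * (2 * δ * A₀ + δ ^ 2 * (2 * δ * A₂)) := by gcongr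
    _ = _ := by ring

lemma norm_e_sub_one_le (ξ : ℝ) : ‖e ξ - 1‖ ≤ 2 * Real.pi * |ξ| := by
  have : e ξ = Complex.exp (Complex.I * ((2 * Real.pi * ξ : ℝ) : ℂ)) := by
    rw [e]
    congr 1
    push_cast
    ring
  rw [this]
  refine (Real.norm_exp_I_mul_ofReal_sub_one_le).trans (le_of_eq ?_)
  rw [Real.norm_eq_abs, abs_mul, abs_of_pos (by positivity)]

namespace IsAdaptedBump

variable {A δ : ℝ} {φ : ℝ → ℝ}

lemma nonneg (h : IsAdaptedBump A δ φ) : 0 ≤ A := by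
  have := h.bound 0 (by norm_num) 0
  rw [pow_zero, div_one] at this
  exact (abs_nonneg _).trans this

lemma hasDerivAt (h : IsAdaptedBump A δ φ) (ξ : ℝ) : HasDerivAt φ (deriv φ ξ) ξ :=
  ((h.smooth.differentiable (by simp)) ξ).hasDerivAt

lemma contDiff_deriv (h : IsAdaptedBump A δ φ) : ContDiff ℝ ∞ (deriv φ) :=
  (contDiff_infty_iff_deriv.1 h.smooth).2

lemma hasDerivAt_deriv (h : IsAdaptedBump A δ φ) (ξ : ℝ) :
    HasDerivAt (deriv φ) (deriv (deriv φ) ξ) ξ :=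
  ((h.contDiff_deriv.differentiable (by simp)) ξ).hasDerivAt

lemma continuous_deriv_deriv (h : IsAdaptedBump A δ φ) : Continuous (deriv (deriv φ)) :=
  ((contDiff_infty_iff_deriv.1 h.contDiff_deriv).2).continuous

lemma deriv_eq_zero_of_forall {g : ℝ → ℝ} (hg : ∀ ξ, δ < |ξ| → g ξ = 0) (ξ : ℝ) (hξ : δ < |ξ|) :
    deriv g ξ = 0 := by
  have : g =ᶠ[nhds ξ] fun _ => 0 := by
    filter_upwards [(isOpen_lt continuous_const continuous_abs).mem_nhds hξ] with η hη
    exact hg η hη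
  rw [this.deriv_eq, deriv_const]

lemma abs_le (h : IsAdaptedBump A δ φ) (ξ : ℝ) : |φ ξ| ≤ A := by
  simpa using h.bound 0 (by norm_num) ξ

lemma abs_deriv_le (h : IsAdaptedBump A δ φ) (ξ : ℝ) : |deriv φ ξ| ≤ A / δ := by
  simpa [iteratedDeriv_one] using h.bound 1 (by norm_num) ξ

lemma abs_deriv_deriv_le (h : IsAdaptedBump A δ φ) (ξ : ℝ) : |deriv (deriv φ) ξ| ≤ A / δ ^ 2 := by
  have := h.bound 2 le_rfl ξ
  rwa [iteratedDeriv_succ, iteratedDeriv_one] at this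

lemma norm_bumpKernel_mul_le (h : IsAdaptedBump A δ φ) (hδ : 0 < δ) (m : ℤ) :
    ‖bumpKernel φ m‖ * (1 + δ * |(m : ℝ)|) ^ 2 ≤ 8 * A * δ := by
  have h1 := deriv_eq_zero_of_forall h.support
  refine (norm_integral_mul_e_le hδ.le (g := fun ξ => (φ ξ : ℂ)) (A₀ := A) (A₂ := A / δ ^ 2)
    (fun ξ => (h.hasDerivAt ξ).ofReal_comp) (fun ξ => (h.hasDerivAt_deriv ξ).ofReal_comp)
    (Complex.continuous_ofReal.comp h.continuous_deriv_deriv)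
    (fun ξ hξ => by simp [h.support ξ hξ]) (fun ξ hξ => by simp [h1 ξ hξ])
    (fun ξ hξ => by simp [deriv_eq_zero_of_forall h1 ξ hξ])
    (fun ξ _ => by simpa using h.abs_le ξ) (fun ξ _ => by simpa using h.abs_deriv_deriv_le ξ)
    m).trans (le_of_eq ?_)
  field_simp
  ring

lemma bumpKernel_succ_sub (h : IsAdaptedBump A δ φ) (m : ℤ) :
    bumpKernel φ (m + 1) - bumpKernel φ m = ∫ ξ : ℝ, ((φ ξ : ℂ) * (e (ξ * (1 : ℝ)) - 1)) * e (ξ * m) := by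
  have hint := fun m : ℤ => h.integrable_mul 0 (g := fun ξ => e (ξ * m)) (by fun_prop)
  simp only [sub_zero] at hint
  rw [bumpKernel, bumpKernel, ← integral_sub (hint _) (hint _)]
  refine integral_congr_ae (Filter.Eventually.of_forall fun ξ => ?_)
  simp only
  push_cast
  rw [mul_add, e_add]
  ring

/-- The difference is the transform of `φ(ξ) (e(ξ) - 1)`. This is again adapted to `[-δ, δ]`, with
height `O(A δ)`, which gives the extra factor `δ`. -/
lemma norm_bumpKernel_succ_sub_mul_le (h : IsAdaptedBump A δ φ) (hδ : 0 < δ) (hδ1 : δ ≤ 1) (m : ℤ) :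
    ‖bumpKernel φ (m + 1) - bumpKernel φ m‖ * (1 + δ * |(m : ℝ)|) ^ 2 ≤ 300 * A * δ * δ := by
  rw [h.bumpKernel_succ_sub]
  have hA := h.nonneg
  have h1 := deriv_eq_zero_of_forall h.support
  have h2 := deriv_eq_zero_of_forall h1
  have hpi := Real.pi_pos
  have hpi' := Real.pi_lt_d2
  set c : ℂ := 2 * Real.pi * (1 : ℝ) * Complex.I with hc
  have hcn : ‖c‖ = 2 * Real.pi := by simp [hc, abs_of_pos hpi]
  have he : ∀ ξ, |ξ| ≤ δ → ‖e (ξ * (1 : ℝ)) - 1‖ ≤ 2 * Real.pi * δ := by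
    intro ξ hξ
    rw [mul_one]
    exact (norm_e_sub_one_le ξ).trans (by gcongr)
  have hφ : ∀ ξ, HasDerivAt (fun ξ => (φ ξ : ℂ)) ((deriv φ ξ : ℝ) : ℂ) ξ :=
    fun ξ => (h.hasDerivAt ξ).ofReal_comp
  have hφ' : ∀ ξ, HasDerivAt (fun ξ => ((deriv φ ξ : ℝ) : ℂ)) ((deriv (deriv φ) ξ : ℝ) : ℂ) ξ :=
    fun ξ => (h.hasDerivAt_deriv ξ).ofReal_comp
  have hE : ∀ ξ, HasDerivAt (fun ξ : ℝ => e (ξ * (1 : ℝ)) - 1) (c * e (ξ * (1 : ℝ))) ξ :=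
    fun ξ => (hasDerivAt_e_mul 1 ξ).sub_const 1
  have hE' : ∀ ξ, HasDerivAt (fun ξ : ℝ => c * e (ξ * (1 : ℝ))) (c * (c * e (ξ * (1 : ℝ)))) ξ :=
    fun ξ => (hasDerivAt_e_mul 1 ξ).const_mul c
  have hcont2 : Continuous fun ξ => ((deriv (deriv φ) ξ : ℝ) : ℂ) :=
    Complex.continuous_ofReal.comp h.continuous_deriv_deriv
  have hcont1 : Continuous fun ξ => ((deriv φ ξ : ℝ) : ℂ) :=
    Complex.continuous_ofReal.comp h.contDiff_deriv.continuous
  have hcont0 : Continuous fun ξ => ((φ ξ : ℝ) : ℂ) :=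
    Complex.continuous_ofReal.comp h.continuous
  refine (norm_integral_mul_e_le hδ.le (g := fun ξ => (φ ξ : ℂ) * (e (ξ * (1 : ℝ)) - 1))
    (A₀ := A * (2 * Real.pi * δ))
    (A₂ := (A / δ ^ 2 * (2 * Real.pi * δ) + A / δ * (2 * Real.pi)) +
      (A / δ * (2 * Real.pi) + A * (2 * Real.pi * (2 * Real.pi))))
    (fun ξ => (hφ ξ).mul (hE ξ))
    (fun ξ => ((hφ' ξ).mul (hE ξ)).add ((hφ ξ).mul (hE' ξ)))
    (by fun_prop)
    (fun ξ hξ => by simp [h.support ξ hξ])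
    (fun ξ hξ => by simp [h.support ξ hξ, h1 ξ hξ])
    (fun ξ hξ => by simp [h.support ξ hξ, h1 ξ hξ, h2 ξ hξ])
    (fun ξ hξ => ?_) (fun ξ hξ => ?_) m).trans ?_
  · rw [norm_mul, Complex.norm_real, Real.norm_eq_abs]
    exact mul_le_mul (h.abs_le ξ) (he ξ hξ) (norm_nonneg _) hA
  · have hb0 := h.abs_le ξ
    have hb1 := h.abs_deriv_le ξ
    have hb2 := h.abs_deriv_deriv_le ξ
    refine (norm_add_le _ _).trans (add_le_add ((norm_add_le _ _).trans (add_le_add ?_ ?_))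
      ((norm_add_le _ _).trans (add_le_add ?_ ?_)))
    · rw [norm_mul, Complex.norm_real, Real.norm_eq_abs]
      exact mul_le_mul hb2 (he ξ hξ) (norm_nonneg _) (by positivity)
    · rw [norm_mul, Complex.norm_real, Real.norm_eq_abs, norm_mul, norm_e, mul_one, hcn]
      gcongr
    · rw [norm_mul, Complex.norm_real, Real.norm_eq_abs, norm_mul, norm_e, mul_one, hcn]
      gcongr
    · rw [norm_mul, Complex.norm_real, Real.norm_eq_abs, norm_mul c, norm_mul c, norm_e, mul_one, hcn]
      gcongr
  · have h3 : 4 * δ * (A * (2 * Real.pi * δ) + δ ^ 2 * ((A / δ ^ 2 * (2 * Real.pi * δ) +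
        A / δ * (2 * Real.pi)) + (A / δ * (2 * Real.pi) + A * (2 * Real.pi * (2 * Real.pi))))) =
        (32 * Real.pi + 16 * Real.pi ^ 2 * δ) * (A * δ * δ) := by
      field_simp
      ring
    -- The constant is `32π + 16π² δ`, which is below 300 for `δ ≤ 1`.
    rw [h3, show 300 * A * δ * δ = 300 * (A * δ * δ) by ring]
    gcongr
    have : Real.pi ^ 2 * δ ≤ 10 := by nlinarith
    nlinarith

end IsAdaptedBump

/-! ### Sums of the decay weight along arithmetic progressions. -/

/-- The weight `δ / (1 + δ |m|)²` dominating the kernel of a bump of width `δ`. -/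
noncomputable def decayWeight (δ : ℝ) (m : ℤ) : ℝ := δ / (1 + δ * |(m : ℝ)|) ^ 2

lemma decayWeight_nonneg {δ : ℝ} (hδ : 0 < δ) (m : ℤ) : 0 ≤ decayWeight δ m := by
  unfold decayWeight; positivity

lemma sum_range_div_sq_le {h : ℝ} (hh : 0 < h) (M : ℕ) :
    ∑ k ∈ Finset.range M, 1 / (1 + h * (k : ℝ)) ^ 2 ≤ 1 + 1 / h := by
  -- The stronger bound telescopes, by comparing each term with `1 / ((1 + h k) (1 + h (k + 1)))`.
  have key : ∀ M : ℕ, ∑ k ∈ Finset.range (M + 1), 1 / (1 + h * (k : ℝ)) ^ 2 ≤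
      1 + (1 / h) * (1 - 1 / (1 + h * M)) := by
    intro M
    induction M with
    | zero => simp
    | succ M ih =>
      rw [Finset.sum_range_succ]
      have h1 : 1 / (1 + h * ((M + 1 : ℕ) : ℝ)) ^ 2 ≤
          (1 / h) * (1 / (1 + h * M) - 1 / (1 + h * ((M + 1 : ℕ) : ℝ))) := by
        have hM : (0 : ℝ) < 1 + h * M := by positivity
        have hM' : (0 : ℝ) < 1 + h * ((M + 1 : ℕ) : ℝ) := by positivity
        have h2 : (1 / h) * (1 / (1 + h * M) - 1 / (1 + h * ((M + 1 : ℕ) : ℝ))) =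
            1 / ((1 + h * M) * (1 + h * ((M + 1 : ℕ) : ℝ))) := by
          push_cast at hM' ⊢
          field_simp
          ring
        rw [h2]
        apply one_div_le_one_div_of_le (by positivity)
        rw [pow_two]
        gcongr
        linarith
      linarith
  rcases M with _ | M
  · simp; positivity
  · refine (key M).trans ?_
    gcongr
    refine mul_le_of_le_one_right (by positivity) ?_
    rw [sub_le_self_iff]
    positivity

lemma sum_decayWeight_le_of_injOn {δ : ℝ} (hδ : 0 < δ) {g : ℕ} (hg : 0 < g) (hgδ : g * δ ≤ 1)
    (T : Finset ℤ) (c : ℤ → ℕ) (hc : Set.InjOn c T) (hT : ∀ t ∈ T, (g : ℤ) * c t ≤ |t|) :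
    ∑ t ∈ T, decayWeight δ t ≤ 2 / g := by
  have hgR : (0 : ℝ) < g := by exact_mod_cast hg
  have h1 : ∀ t ∈ T, decayWeight δ t ≤ δ * (1 / (1 + (g * δ) * (c t : ℝ)) ^ 2) := by
    intro t ht
    rw [decayWeight, div_eq_mul_one_div]
    have : (g : ℝ) * c t ≤ |(t : ℝ)| := by exact_mod_cast hT t ht
    have h2 : g * δ * (c t : ℝ) ≤ δ * |(t : ℝ)| := by nlinarith
    exact mul_le_mul_of_nonneg_left (one_div_le_one_div_of_le (by positivity)
      (pow_le_pow_left₀ (by positivity) (by linarith) 2)) hδ.le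
  obtain ⟨M, hM⟩ := (T.image c).exists_nat_subset_range
  calc ∑ t ∈ T, decayWeight δ t ≤ ∑ t ∈ T, δ * (1 / (1 + (g * δ) * (c t : ℝ)) ^ 2) :=
        Finset.sum_le_sum h1
    _ = ∑ k ∈ T.image c, δ * (1 / (1 + (g * δ) * (k : ℝ)) ^ 2) :=
        (Finset.sum_image (f := fun k : ℕ => δ * (1 / (1 + (g * δ) * (k : ℝ)) ^ 2)) hc).symm
    _ ≤ ∑ k ∈ Finset.range M, δ * (1 / (1 + (g * δ) * (k : ℝ)) ^ 2) :=
        Finset.sum_le_sum_of_subset_of_nonneg hM (fun _ _ _ => by positivity)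
    _ ≤ δ * (1 + 1 / (g * δ)) := by
        rw [← Finset.mul_sum]
        gcongr
        exact sum_range_div_sq_le (by positivity) M
    _ ≤ 2 / g := by
        rw [le_div_iff₀ hgR]
        have : δ * (1 + 1 / (g * δ)) * g = g * δ + 1 := by field_simp
        linarith

/-- A progression of step `g ≤ 1/δ` captures a proportion `O(1/g)` of the bounded total mass. Each
half-line contributes `2/g`. -/
lemma sum_decayWeight_le {δ : ℝ} (hδ : 0 < δ) {g : ℕ} (hg : 0 < g) (hgδ : g * δ ≤ 1)
    (T : Finset ℤ) (hT : ∀ t ∈ T, ∀ t' ∈ T, (g : ℤ) ∣ t - t') :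
    ∑ t ∈ T, decayWeight δ t ≤ 4 / g := by
  have hgZ : (0 : ℤ) < g := by exact_mod_cast hg
  have hinj : ∀ t ∈ T, ∀ t' ∈ T, t / g = t' / g → t = t' := by
    intro t ht t' ht' h
    have h1 : t % g = t' % g := Int.emod_eq_emod_iff_emod_sub_eq_zero.2
      (Int.emod_eq_zero_of_dvd (hT t ht t' ht'))
    rw [← Int.mul_ediv_add_emod t g, ← Int.mul_ediv_add_emod t' g, h, h1]
  rw [← Finset.sum_filter_add_sum_filter_not T (fun t => 0 ≤ t)]
  have h1 := sum_decayWeight_le_of_injOn hδ hg hgδ (T.filter fun t => 0 ≤ t)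
    (fun t => (t / g).toNat) ?_ ?_
  -- For negative `t` the floor quotient is at most `-1`, so `-(t/g) - 1` numbers the blocks from 0
  -- and keeps `g c(t) ≤ |t|`.
  have h2 := sum_decayWeight_le_of_injOn hδ hg hgδ (T.filter fun t => ¬ 0 ≤ t)
    (fun t => (-(t / g) - 1).toNat) ?_ ?_
  · calc _ ≤ 2 / (g : ℝ) + 2 / g := add_le_add h1 h2
      _ = 4 / g := by ring
  · intro t ht t' ht' h
    simp only [Finset.coe_filter, Set.mem_ofPred_eq] at ht ht' h
    have := Int.ediv_lt_of_lt_mul hgZ (a := t) (b := 0) (by omega)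
    have := Int.ediv_lt_of_lt_mul hgZ (a := t') (b := 0) (by omega)
    exact hinj t ht.1 t' ht'.1 (by omega)
  · intro t ht
    have ht := (Finset.mem_filter.1 ht).2
    have h0 := Int.ediv_lt_of_lt_mul hgZ (a := t) (b := 0) (by omega)
    rw [Int.toNat_of_nonneg (by omega), abs_of_neg (by omega)]
    have := Int.lt_ediv_add_one_mul_self t hgZ
    nlinarith
  · intro t ht t' ht' h
    simp only [Finset.coe_filter, Set.mem_ofPred_eq] at ht ht' h
    have := Int.ediv_nonneg ht.2 hgZ.le
    have := Int.ediv_nonneg ht'.2 hgZ.le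
    exact hinj t ht.1 t' ht'.1 (by omega)
  · intro t ht
    have ht := (Finset.mem_filter.1 ht).2
    rw [Int.toNat_of_nonneg (Int.ediv_nonneg ht hgZ.le), abs_of_nonneg ht]
    exact Int.mul_ediv_self_le hgZ.ne'

lemma sum_decayWeight_le_four {δ : ℝ} (hδ : 0 < δ) (hδ1 : δ ≤ 1) (T : Finset ℤ) :
    ∑ t ∈ T, decayWeight δ t ≤ 4 := by
  simpa using sum_decayWeight_le hδ (g := 1) one_pos (by simpa using hδ1) T (by simp)

lemma summable_decayWeight {δ : ℝ} (hδ : 0 < δ) (hδ1 : δ ≤ 1) : Summable (decayWeight δ) :=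
  summable_of_sum_le (decayWeight_nonneg hδ) (sum_decayWeight_le_four hδ hδ1)

lemma tsum_decayWeight_le {δ : ℝ} (hδ : 0 < δ) (hδ1 : δ ≤ 1) : ∑' m, decayWeight δ m ≤ 4 :=
  (summable_decayWeight hδ hδ1).tsum_le_of_sum_le (sum_decayWeight_le_four hδ hδ1)

lemma sum_decayWeight_comp_sub_le {δ : ℝ} (hδ : 0 < δ) {g : ℕ} (hg : 0 < g) (hgδ : g * δ ≤ 1)
    (X : Finset ℤ) (y z : ℤ) :
    ∑ x ∈ X.filter (fun x => (g : ℤ) ∣ y - x), decayWeight δ (z - x) ≤ 4 / g := by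
  rw [← Finset.sum_image (s := X.filter _) (g := fun x => z - x) (f := decayWeight δ)
    (fun x _ x' _ h => by simpa using h)]
  refine sum_decayWeight_le hδ hg hgδ _ fun t ht t' ht' => ?_
  obtain ⟨x, hx, rfl⟩ := Finset.mem_image.1 ht
  obtain ⟨x', hx', rfl⟩ := Finset.mem_image.1 ht'
  rw [show z - x - (z - x') = (y - x) - (y - x') by ring]
  exact dvd_sub (Finset.mem_filter.1 hx).2 (Finset.mem_filter.1 hx').2

/-! ### Averaging a periodic phase, and Schur's test. -/

lemma sum_range_add_of_periodic {N : ℕ} {c : ℤ → ℂ} (hc : ∀ z, c (z + N) = c z) (z : ℤ) :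
    ∑ m ∈ Finset.range N, c (z + m) = ∑ m ∈ Finset.range N, c m := by
  have hstep : ∀ z : ℤ, ∑ m ∈ Finset.range N, c (z + 1 + m) = ∑ m ∈ Finset.range N, c (z + m) := by
    intro z
    have h1 := Finset.sum_range_succ (fun m : ℕ => c (z + m)) N
    have h2 := Finset.sum_range_succ' (fun m : ℕ => c (z + m)) N
    simp only [Nat.cast_add, Nat.cast_one, CharP.cast_eq_zero, add_zero, hc] at h1 h2
    rw [h1] at h2
    rw [add_right_cancel h2]
    exact Finset.sum_congr rfl fun m _ => by rw [add_assoc, add_comm 1]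
  induction z using Int.induction_on with
  | zero => simp
  | succ i ih => rw [hstep, ih]
  | pred i ih => rw [← ih, ← hstep, sub_add_cancel]

/-- Sums of a periodic function against a slowly varying weight. -/
lemma norm_tsum_periodic_mul_le {N : ℕ} {c W : ℤ → ℂ} {V : ℤ → ℝ}
    (hc : ∀ z, c (z + N) = c z) (hc1 : ∀ z, ‖c z‖ ≤ 1) (hW : Summable fun z => ‖W z‖)
    (hV : Summable V) (hWV : ∀ z, ‖W (z + 1) - W z‖ ≤ V z) :
    N * ‖∑' z, c z * W z‖ ≤ ‖∑ m ∈ Finset.range N, c m‖ * ∑' z, ‖W z‖ + N * (N * ∑' z, V z) := by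
  have hV0 : ∀ z, 0 ≤ V z := fun z => (norm_nonneg _).trans (hWV z)
  have hsum : ∀ c' : ℤ → ℂ, (∀ z, ‖c' z‖ ≤ 1) → Summable fun z => c' z * W z := fun c' hc' =>
    Summable.of_norm_bounded hW fun z => by
      rw [norm_mul]; exact mul_le_of_le_one_left (norm_nonneg _) (hc' z)
  have hWm : ∀ (m : ℕ) (z : ℤ), ‖W (z + m) - W z‖ ≤ ∑ j ∈ Finset.range m, V (z + j) := by
    intro m z
    induction m with
    | zero => simp
    | succ m ih =>
      rw [Finset.sum_range_succ]
      have : W (z + (m + 1 : ℕ)) - W z = (W (z + m) - W z) + (W (z + m + 1) - W (z + m)) := by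
        push_cast; rw [add_assoc]; ring
      rw [this]
      exact (norm_add_le _ _).trans (add_le_add ih (hWV _))
  have hVs : ∀ j : ℕ, HasSum (fun z : ℤ => V (z + j)) (∑' z, V z) := fun j =>
    (Equiv.addRight (j : ℤ)).hasSum_iff.2 hV.hasSum
  have hdiff : ∀ m : ℕ, Summable (fun z => c (z + m) * (W (z + m) - W z)) ∧
      ‖∑' z, c (z + m) * (W (z + m) - W z)‖ ≤ m * ∑' z, V z := by
    intro m
    have hS : HasSum (fun z : ℤ => ∑ j ∈ Finset.range m, V (z + j)) (m * ∑' z, V z) := by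
      have := hasSum_sum (s := Finset.range m) fun j _ => hVs j
      simpa using this
    have hb : ∀ z : ℤ, ‖c (z + m) * (W (z + m) - W z)‖ ≤ ∑ j ∈ Finset.range m, V (z + j) := by
      intro z
      rw [norm_mul]
      exact (mul_le_of_le_one_left (norm_nonneg _) (hc1 _)).trans (hWm m z)
    exact ⟨Summable.of_norm_bounded hS.summable hb, tsum_of_norm_bounded hS hb⟩
  have hshift : ∀ m : ℕ, ∑' z, c z * W z =
      ∑' z, c (z + m) * W z + ∑' z, c (z + m) * (W (z + m) - W z) := by
    intro m
    rw [← (hsum (fun z => c (z + m)) fun z => hc1 _).tsum_add (hdiff m).1,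
      ← (Equiv.addRight (m : ℤ)).tsum_eq]
    refine tsum_congr fun z => ?_
    simp only [Equiv.coe_addRight]
    ring
  -- Average the sum over its translates by `m < N` and freeze `W(z + m)` at `W(z)`. Periodicity
  -- turns the main term into a complete sum, and the error is controlled by the variation `V`.
  have hmain : (N : ℂ) * ∑' z, c z * W z = (∑ m ∈ Finset.range N, c m) * ∑' z, W z +
      ∑ m ∈ Finset.range N, ∑' z, c (z + m) * (W (z + m) - W z) := by
    calc (N : ℂ) * ∑' z, c z * W z = ∑ m ∈ Finset.range N, ∑' z, c z * W z := by simp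
      _ = ∑ m ∈ Finset.range N, ∑' z, c (z + m) * W z +
          ∑ m ∈ Finset.range N, ∑' z, c (z + m) * (W (z + m) - W z) := by
        rw [← Finset.sum_add_distrib]
        exact Finset.sum_congr rfl fun m _ => hshift m
      _ = _ := by
        congr 1
        rw [← Summable.tsum_finsetSum (fun (m : ℕ) _ => hsum (fun z => c (z + m)) fun z => hc1 _),
          ← tsum_mul_left]
        refine tsum_congr fun z => ?_
        rw [← Finset.sum_mul, sum_range_add_of_periodic hc]
  have hNn : (N : ℝ) * ‖∑' z, c z * W z‖ = ‖(N : ℂ) * ∑' z, c z * W z‖ := by simp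
  rw [hNn, hmain]
  refine (norm_add_le _ _).trans (add_le_add ?_ ?_)
  · rw [norm_mul]
    gcongr
    exact norm_tsum_le_tsum_norm hW
  · calc _ ≤ ∑ m ∈ Finset.range N, (N : ℝ) * ∑' z, V z := by
          refine (norm_sum_le _ _).trans (Finset.sum_le_sum fun m hm => (hdiff m).2.trans ?_)
          have : (0 : ℝ) ≤ ∑' z, V z := tsum_nonneg hV0
          gcongr
          exact (Finset.mem_range.1 hm).le
      _ = _ := by simp

/-- The `TT*` argument with Schur's test. -/
lemma sum_norm_sq_le_of_schur {X S : Finset ℤ} {k : ℤ → ℤ → ℂ} {Γ : ℝ} (hΓ0 : 0 ≤ Γ)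
    (hk : ∀ x ∈ X, ∀ y ∈ X, Summable fun n => (starRingEnd ℂ) (k x n) * k y n)
    (hΓ : ∀ y ∈ X, ∑ x ∈ X, ‖∑' n, (starRingEnd ℂ) (k x n) * k y n‖ ≤ Γ) (f : ℤ → ℂ) :
    ∑ x ∈ X, ‖∑ n ∈ S, f n * k x n‖ ^ 2 ≤ Γ * ∑ n ∈ S, ‖f n‖ ^ 2 := by
  set h : ℤ → ℂ := fun x => ∑ n ∈ S, f n * k x n with hh
  -- `G` is the adjoint applied to the output, and `Q` is a pairing of `f` with `G`. Its norm is
  -- taken over all of `ℤ`, so the `TT*` kernel is a full sum in `n`, independent of `S`.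
  set G : ℤ → ℂ := fun n => ∑ x ∈ X, (starRingEnd ℂ) (k x n) * h x with hG
  set Q := ∑ x ∈ X, ‖h x‖ ^ 2 with hQ
  have hQ0 : 0 ≤ Q := by positivity
  set K : ℤ → ℤ → ℂ := fun x y => ∑' n, (starRingEnd ℂ) (k x n) * k y n with hK
  have hKsymm : ∀ x y, ‖K x y‖ = ‖K y x‖ := by
    intro x y
    rw [← Complex.norm_conj, hK]
    simp only [Complex.conj_tsum, map_mul, Complex.conj_conj]
    congr 1
    exact tsum_congr fun n => mul_comm _ _
  have hGsq : ∀ n, ((‖G n‖ ^ 2 : ℝ) : ℂ) = ∑ x ∈ X, ∑ y ∈ X,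
      h x * (starRingEnd ℂ) (h y) * ((starRingEnd ℂ) (k x n) * k y n) := by
    intro n
    push_cast
    rw [← Complex.mul_conj', hG, map_sum, Finset.sum_mul_sum]
    refine Finset.sum_congr rfl fun x _ => Finset.sum_congr rfl fun y _ => ?_
    simp only [map_mul, Complex.conj_conj]
    ring
  have hGhas : HasSum (fun n => ((‖G n‖ ^ 2 : ℝ) : ℂ))
      (∑ x ∈ X, ∑ y ∈ X, h x * (starRingEnd ℂ) (h y) * K x y) := by
    simp_rw [hGsq]
    exact hasSum_sum fun x hx => hasSum_sum fun y hy => (hk x hx y hy).hasSum.mul_left _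
  have hGsum : Summable fun n => ‖G n‖ ^ 2 := by
    exact_mod_cast Complex.summable_ofReal.1 hGhas.summable
  have hGle : ∑' n, ‖G n‖ ^ 2 ≤ Γ * Q := by
    have h1 : ((∑' n, ‖G n‖ ^ 2 : ℝ) : ℂ) = ∑ x ∈ X, ∑ y ∈ X, h x * (starRingEnd ℂ) (h y) * K x y := by
      rw [Complex.ofReal_tsum]; exact hGhas.tsum_eq
    have h2 : ∑' n, ‖G n‖ ^ 2 = ‖((∑' n, ‖G n‖ ^ 2 : ℝ) : ℂ)‖ := by
      rw [Complex.norm_real, Real.norm_of_nonneg (tsum_nonneg fun n => by positivity)]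
    rw [h2, h1]
    calc _ ≤ ∑ x ∈ X, ∑ y ∈ X, (‖h x‖ ^ 2 * ‖K y x‖ / 2 + ‖h y‖ ^ 2 * ‖K x y‖ / 2) := by
          refine (norm_sum_le _ _).trans (Finset.sum_le_sum fun x _ => (norm_sum_le _ _).trans
            (Finset.sum_le_sum fun y _ => ?_))
          rw [norm_mul, norm_mul, Complex.norm_conj, hKsymm y x]
          nlinarith [mul_nonneg (sq_nonneg (‖h x‖ - ‖h y‖)) (norm_nonneg (K x y))]
      _ = ∑ x ∈ X, ‖h x‖ ^ 2 * (∑ y ∈ X, ‖K y x‖) := by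
          simp_rw [Finset.sum_add_distrib]
          rw [Finset.sum_comm (f := fun x y => ‖h y‖ ^ 2 * ‖K x y‖ / 2), ← Finset.sum_add_distrib]
          refine Finset.sum_congr rfl fun x _ => ?_
          rw [← Finset.sum_add_distrib, Finset.mul_sum]
          exact Finset.sum_congr rfl fun y _ => by ring
      _ ≤ ∑ x ∈ X, ‖h x‖ ^ 2 * Γ := by
          gcongr with x hx
          exact hΓ x hx
      _ = Γ * Q := by rw [← Finset.sum_mul, mul_comm]
  have hpair : (Q : ℂ) = ∑ n ∈ S, f n * (starRingEnd ℂ) (G n) := by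
    rw [hQ]
    push_cast
    simp_rw [← Complex.mul_conj', hG, map_sum, Finset.mul_sum]
    rw [Finset.sum_comm]
    refine Finset.sum_congr rfl fun x _ => ?_
    conv_lhs => rw [hh]
    simp only
    rw [Finset.sum_mul]
    refine Finset.sum_congr rfl fun n _ => ?_
    simp only [map_mul, Complex.conj_conj, hh]
    ring
  have hQle : Q ^ 2 ≤ (∑ n ∈ S, ‖f n‖ ^ 2) * (Γ * Q) := by
    have h1 : Q ≤ ∑ n ∈ S, ‖f n‖ * ‖G n‖ := by
      calc Q = ‖(Q : ℂ)‖ := by rw [Complex.norm_real, Real.norm_of_nonneg hQ0]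
        _ ≤ _ := by
          rw [hpair]
          refine (norm_sum_le _ _).trans (le_of_eq (Finset.sum_congr rfl fun n _ => ?_))
          rw [norm_mul, Complex.norm_conj]
    calc Q ^ 2 ≤ (∑ n ∈ S, ‖f n‖ * ‖G n‖) ^ 2 := by gcongr
      _ ≤ (∑ n ∈ S, ‖f n‖ ^ 2) * ∑ n ∈ S, ‖G n‖ ^ 2 := Finset.sum_mul_sq_le_sq_mul_sq _ _ _
      _ ≤ _ := by
        gcongr
        exact (hGsum.sum_le_tsum S fun _ _ => by positivity).trans hGle
  rcases hQ0.eq_or_lt with hQz | hQpos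
  · rw [← hQz]
    positivity
  · have : Q * Q ≤ (Γ * ∑ n ∈ S, ‖f n‖ ^ 2) * Q := by nlinarith
    exact le_of_mul_le_mul_right this hQpos

/-! ### The `TT*` kernel of the linearized maximal operator. -/

/-- The convolution kernel of the Weyl multiplier attached to a reduced fraction `a / q`. -/
noncomputable def weylKernel (d : ℕ) (φ : ℝ → ℝ) (a q : ℕ) (m : ℤ) : ℂ :=
  e (-((a : ℝ) / q * (m : ℝ) ^ d)) * bumpKernel φ m

lemma e_phase_periodic {d a q a' q' : ℕ} (hq : q ≠ 0) (hq' : q' ≠ 0) (u w : ℤ) :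
    e ((a : ℝ) / q * (((w + (q * q' : ℕ) : ℤ) : ℝ)) ^ d -
      (a' : ℝ) / q' * ((((w + (q * q' : ℕ) : ℤ) : ℝ)) + u) ^ d) =
    e ((a : ℝ) / q * (w : ℝ) ^ d - (a' : ℝ) / q' * ((w : ℝ) + u) ^ d) := by
  have hqR : (q : ℝ) ≠ 0 := by exact_mod_cast hq
  have hqR' : (q' : ℝ) ≠ 0 := by exact_mod_cast hq'
  obtain ⟨c, hc⟩ := sub_dvd_pow_sub_pow (w + (q * q' : ℕ) : ℤ) w d
  obtain ⟨c', hc'⟩ := sub_dvd_pow_sub_pow (w + (q * q' : ℕ) + u : ℤ) (w + u) d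
  have h1 : (((w + (q * q' : ℕ) : ℤ) : ℝ)) ^ d = (w : ℝ) ^ d + q * q' * c := by
    have : (w + (q * q' : ℕ) : ℤ) ^ d = w ^ d + q * q' * c := by
      rw [← sub_eq_iff_eq_add', hc]; push_cast; ring
    exact_mod_cast this
  have h2 : ((((w + (q * q' : ℕ) : ℤ) : ℝ)) + u) ^ d = ((w : ℝ) + u) ^ d + q * q' * c' := by
    have : (w + (q * q' : ℕ) + u : ℤ) ^ d = (w + u) ^ d + q * q' * c' := by
      rw [← sub_eq_iff_eq_add', hc']; push_cast; ring
    exact_mod_cast this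
  rw [h1, h2,
    ← e_add_intCast ((a : ℝ) / q * (w : ℝ) ^ d - (a' : ℝ) / q' * ((w : ℝ) + u) ^ d)
      (a * q' * c - a' * q * c')]
  congr 1
  push_cast
  field_simp
  ring

lemma decayWeight_le_one {δ : ℝ} (hδ : 0 < δ) (hδ1 : δ ≤ 1) (m : ℤ) : decayWeight δ m ≤ 1 := by
  refine div_le_one_of_le₀ (hδ1.trans (one_le_pow₀ ?_)) (by positivity)
  rw [le_add_iff_nonneg_right]
  positivity

lemma summable_decayWeight_mul {δ : ℝ} (hδ : 0 < δ) (hδ1 : δ ≤ 1) (u : ℤ) :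
    Summable fun w => decayWeight δ w * decayWeight δ (w + u) :=
  Summable.of_nonneg_of_le (fun _ => mul_nonneg (decayWeight_nonneg hδ _) (decayWeight_nonneg hδ _))
    (fun _ => mul_le_of_le_one_right (decayWeight_nonneg hδ _) (decayWeight_le_one hδ hδ1 _))
    (summable_decayWeight hδ hδ1)

lemma sum_mul_tsum_decayWeight_le {δ : ℝ} (hδ : 0 < δ) (hδ1 : δ ≤ 1) {X : Finset ℤ} {ρ : ℤ → ℝ}
    {M : ℝ} (y : ℤ) (hM : ∀ z, ∑ x ∈ X, ρ x * decayWeight δ (z - x) ≤ M) (hM0 : 0 ≤ M) :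
    ∑ x ∈ X, ρ x * ∑' w, decayWeight δ w * decayWeight δ (w + (y - x)) ≤ 4 * M := by
  have hs := fun u => summable_decayWeight_mul hδ hδ1 u
  calc _ = ∑' w, ∑ x ∈ X, ρ x * (decayWeight δ w * decayWeight δ (w + (y - x))) := by
        simp_rw [← tsum_mul_left]
        rw [Summable.tsum_finsetSum fun x _ => (hs _).mul_left _]
    _ ≤ ∑' w, decayWeight δ w * M := by
        refine Summable.tsum_le_tsum (fun w => ?_) (summable_sum fun x _ => (hs _).mul_left _)
          ((summable_decayWeight hδ hδ1).mul_right M)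
        calc _ = decayWeight δ w * ∑ x ∈ X, ρ x * decayWeight δ (w + y - x) := by
              rw [Finset.mul_sum]
              refine Finset.sum_congr rfl fun x _ => ?_
              rw [add_sub_assoc]; ring
          _ ≤ _ := mul_le_mul_of_nonneg_left (hM _) (decayWeight_nonneg hδ w)
    _ ≤ 4 * M := by
        rw [tsum_mul_right]
        exact mul_le_mul_of_nonneg_right (tsum_decayWeight_le hδ hδ1) hM0

/-- Bound the term with `gcd(q, y - x)` by a sum over all divisors `g` of `q` with `g ∣ y - x`. Such
`x` have weighted density `O(1/g)`, which outweighs `g^κ`, so every divisor costs at most `4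
q^(-κ)`. -/
lemma sum_rpow_gcd_mul_decayWeight_le {δ κ : ℝ} (hδ : 0 < δ) (hκ1 : κ ≤ 1) {q : ℕ}
    (hq : q ≠ 0) (hqδ : q * δ ≤ 1) (X : Finset ℤ) (y z : ℤ) :
    ∑ x ∈ X, ((q / Int.gcd q (y - x) : ℕ) : ℝ) ^ (-κ) * decayWeight δ (z - x) ≤
      4 * (q.divisors.card * (q : ℝ) ^ (-κ)) := by
  have hle : ∀ x, ((q / Int.gcd q (y - x) : ℕ) : ℝ) ^ (-κ) ≤
      ∑ g ∈ q.divisors, if (g : ℤ) ∣ y - x then (q : ℝ) ^ (-κ) * (g : ℝ) ^ κ else 0 := by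
    intro x
    have hdvd : Int.gcd q (y - x) ∣ q := by exact_mod_cast Int.gcd_dvd_left (q : ℤ) (y - x)
    have hpos : 0 < Int.gcd q (y - x) := Nat.pos_of_dvd_of_pos hdvd (Nat.pos_of_ne_zero hq)
    refine le_trans (le_of_eq ?_) (Finset.single_le_sum (fun g _ => ?_)
      (Nat.mem_divisors.2 ⟨hdvd, hq⟩))
    · rw [if_pos (Int.gcd_dvd_right _ _), Nat.cast_div hdvd (by exact_mod_cast hpos.ne'),
        Real.div_rpow (by positivity) (by positivity), Real.rpow_neg (Nat.cast_nonneg (Int.gcd _ _)),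
        div_inv_eq_mul]
    · split_ifs <;> positivity
  calc _ ≤ ∑ x ∈ X, ∑ g ∈ q.divisors,
        (if (g : ℤ) ∣ y - x then (q : ℝ) ^ (-κ) * (g : ℝ) ^ κ else 0) * decayWeight δ (z - x) := by
        refine Finset.sum_le_sum fun x _ => ?_
        rw [← Finset.sum_mul]
        exact mul_le_mul_of_nonneg_right (hle x) (decayWeight_nonneg hδ _)
    _ = ∑ g ∈ q.divisors, (q : ℝ) ^ (-κ) * (g : ℝ) ^ κ *
        ∑ x ∈ X.filter (fun x => (g : ℤ) ∣ y - x), decayWeight δ (z - x) := by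
        rw [Finset.sum_comm]
        refine Finset.sum_congr rfl fun g _ => ?_
        simp_rw [ite_mul, zero_mul]
        rw [← Finset.sum_filter, Finset.mul_sum]
    _ ≤ ∑ g ∈ q.divisors, 4 * (q : ℝ) ^ (-κ) := by
        refine Finset.sum_le_sum fun g hg => ?_
        have hgq := Nat.le_of_dvd (Nat.pos_of_ne_zero hq) (Nat.dvd_of_mem_divisors hg)
        have hg0 := Nat.pos_of_mem_divisors hg
        have hgqR : (g : ℝ) ≤ q := by exact_mod_cast hgq
        have hg1 : (1 : ℝ) ≤ g := by exact_mod_cast hg0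
        have h1 := sum_decayWeight_comp_sub_le hδ hg0
          ((mul_le_mul_of_nonneg_right hgqR hδ.le).trans hqδ) X y z
        have h2 : (g : ℝ) ^ κ ≤ g := by
          conv_rhs => rw [← Real.rpow_one (g : ℝ)]
          exact Real.rpow_le_rpow_of_exponent_le hg1 hκ1
        have h3 := Finset.sum_nonneg fun x (_ : x ∈ X.filter fun x => (g : ℤ) ∣ y - x) =>
          decayWeight_nonneg hδ (z - x)
        calc _ ≤ (q : ℝ) ^ (-κ) * (g : ℝ) * (4 / g) := by gcongr
          _ = _ := by field_simp
    _ = _ := by rw [Finset.sum_const, nsmul_eq_mul]; ring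

namespace IsAdaptedBump

variable {A δ : ℝ} {φ : ℝ → ℝ}

lemma norm_bumpKernel_le (h : IsAdaptedBump A δ φ) (hδ : 0 < δ) (m : ℤ) :
    ‖bumpKernel φ m‖ ≤ 300 * A * decayWeight δ m := by
  have h1 := h.norm_bumpKernel_mul_le hδ m
  have hA := h.nonneg
  rw [decayWeight, ← mul_div_assoc, le_div_iff₀ (by positivity)]
  nlinarith [mul_nonneg hA hδ.le]

lemma norm_bumpKernel_succ_sub_le (h : IsAdaptedBump A δ φ) (hδ : 0 < δ) (hδ1 : δ ≤ 1) (m : ℤ) :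
    ‖bumpKernel φ (m + 1) - bumpKernel φ m‖ ≤ 300 * A * (δ * decayWeight δ m) := by
  have h1 := h.norm_bumpKernel_succ_sub_mul_le hδ hδ1 m
  rw [decayWeight, ← mul_div_assoc, ← mul_div_assoc, le_div_iff₀ (by positivity)]
  linarith

lemma norm_weylKernel_le (h : IsAdaptedBump A δ φ) (hδ : 0 < δ) (d a q : ℕ) (m : ℤ) :
    ‖weylKernel d φ a q m‖ ≤ 300 * A * decayWeight δ m := by
  rw [weylKernel, norm_mul, norm_e, one_mul]
  exact h.norm_bumpKernel_le hδ m

lemma summable_conj_weylKernel_mul (h : IsAdaptedBump A δ φ) (hδ : 0 < δ) (hδ1 : δ ≤ 1)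
    (d a q a' q' : ℕ) (x y : ℤ) :
    Summable fun n => (starRingEnd ℂ) (weylKernel d φ a q (x - n)) * weylKernel d φ a' q' (y - n) := by
  rw [← (Equiv.subLeft x).summable_iff]
  refine Summable.of_norm_bounded
    ((summable_decayWeight_mul hδ hδ1 (y - x)).mul_left (300 * A * (300 * A))) fun w => ?_
  have hA := h.nonneg
  simp only [Function.comp_apply, Equiv.subLeft_apply, sub_sub_cancel, norm_mul, Complex.norm_conj]
  rw [show y - (x - w) = w + (y - x) by ring]
  calc _ ≤ (300 * A * decayWeight δ w) * (300 * A * decayWeight δ (w + (y - x))) :=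
        mul_le_mul (h.norm_weylKernel_le hδ ..) (h.norm_weylKernel_le hδ ..) (norm_nonneg _)
          (mul_nonneg (by positivity) (decayWeight_nonneg hδ _))
    _ = _ := by ring

lemma norm_tsum_conj_weylKernel_mul_le (h : IsAdaptedBump A δ φ) (hδ : 0 < δ) (hδ1 : δ ≤ 1)
    {d a q a' q' : ℕ} (hq : q ≠ 0) (hq' : q' ≠ 0) (x y : ℤ) {ρ : ℝ}
    (hρ : ‖∑ r ∈ Finset.range (q * q'), e ((a : ℝ) / q * (r : ℝ) ^ d -
        (a' : ℝ) / q' * ((r : ℝ) + (y - x : ℤ)) ^ d)‖ ≤ ρ * (q * q')) :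
    ‖∑' n, (starRingEnd ℂ) (weylKernel d φ a q (x - n)) * weylKernel d φ a' q' (y - n)‖ ≤
      (300 * A) ^ 2 * (ρ * ∑' w, decayWeight δ w * decayWeight δ (w + (y - x)) +
        q * q' * δ * (∑' w, decayWeight δ w * decayWeight δ (w + (y + 1 - x)) +
          ∑' w, decayWeight δ w * decayWeight δ (w + (y - x)))) := by
  set u : ℤ := y - x with hu
  set B : ℝ := 300 * A with hB
  have hB0 : 0 ≤ B := by have := h.nonneg; positivity
  have hw0 := decayWeight_nonneg hδ
  have hs := fun u => summable_decayWeight_mul hδ hδ1 u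
  set c : ℤ → ℂ := fun w => e ((a : ℝ) / q * (w : ℝ) ^ d - (a' : ℝ) / q' * ((w : ℝ) + u) ^ d) with hc
  set W : ℤ → ℂ := fun w => (starRingEnd ℂ) (bumpKernel φ w) * bumpKernel φ (w + u) with hW
  -- This is the discrete product rule for `W(w + 1) - W(w)`. The shifted factor is kept as an
  -- overlap of weights at `y + 1`, so that the same summation in `x` applies to it.
  set V : ℤ → ℝ := fun w => B ^ 2 * δ * (decayWeight δ w * decayWeight δ (w + (y + 1 - x)) +
    decayWeight δ w * decayWeight δ (w + u)) with hV
  have hsum : ∑' n, (starRingEnd ℂ) (weylKernel d φ a q (x - n)) * weylKernel d φ a' q' (y - n) =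
      ∑' w, c w * W w := by
    rw [← (Equiv.subLeft x).tsum_eq]
    refine tsum_congr fun w => ?_
    simp only [Equiv.subLeft_apply, sub_sub_cancel, weylKernel, map_mul, conj_e, hc, hW]
    rw [show y - (x - w) = w + u by ring, sub_eq_add_neg, e_add, neg_neg]
    push_cast
    ring
  have hWle : ∀ w, ‖W w‖ ≤ B ^ 2 * (decayWeight δ w * decayWeight δ (w + u)) := by
    intro w
    rw [hW, norm_mul, Complex.norm_conj]
    calc _ ≤ (B * decayWeight δ w) * (B * decayWeight δ (w + u)) :=
          mul_le_mul (h.norm_bumpKernel_le hδ _) (h.norm_bumpKernel_le hδ _) (norm_nonneg _)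
            (mul_nonneg hB0 (hw0 _))
      _ = _ := by ring
  have hWs : Summable fun w => ‖W w‖ :=
    Summable.of_nonneg_of_le (fun _ => norm_nonneg _) hWle ((hs u).mul_left _)
  have hWV : ∀ w, ‖W (w + 1) - W w‖ ≤ V w := by
    intro w
    have heq : W (w + 1) - W w =
        (starRingEnd ℂ) (bumpKernel φ (w + 1) - bumpKernel φ w) * bumpKernel φ (w + (y + 1 - x)) +
        (starRingEnd ℂ) (bumpKernel φ w) * (bumpKernel φ (w + u + 1) - bumpKernel φ (w + u)) := by
      simp only [hW, map_sub]
      rw [show w + 1 + u = w + (y + 1 - x) by rw [hu]; ring,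
        show w + u + 1 = w + (y + 1 - x) by rw [hu]; ring]
      ring
    rw [heq]
    refine (norm_add_le _ _).trans ?_
    rw [norm_mul, norm_mul, Complex.norm_conj, Complex.norm_conj]
    calc _ ≤ (B * (δ * decayWeight δ w)) * (B * decayWeight δ (w + (y + 1 - x))) +
          (B * decayWeight δ w) * (B * (δ * decayWeight δ (w + u))) := by
          have := hw0 w
          refine add_le_add (mul_le_mul (h.norm_bumpKernel_succ_sub_le hδ hδ1 _)
            (h.norm_bumpKernel_le hδ _) (norm_nonneg _) (by positivity))
            (mul_le_mul (h.norm_bumpKernel_le hδ _) (h.norm_bumpKernel_succ_sub_le hδ hδ1 _)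
            (norm_nonneg _) (by positivity))
      _ = _ := by simp only [hV]; ring
  have hVs : Summable V := ((hs _).add (hs _)).mul_left _
  have key := norm_tsum_periodic_mul_le (N := q * q') (c := c) (W := W) (V := V)
    (fun w => e_phase_periodic hq hq' u w) (fun w => (norm_e _).le) hWs hVs hWV
  have hVt : ∑' w, V w = B ^ 2 * δ * (∑' w, decayWeight δ w * decayWeight δ (w + (y + 1 - x)) +
          ∑' w, decayWeight δ w * decayWeight δ (w + u)) := by
    rw [hV, tsum_mul_left, (hs _).tsum_add (hs _)]
  have hWt : ∑' w, ‖W w‖ ≤ B ^ 2 * ∑' w, decayWeight δ w * decayWeight δ (w + u) := by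
    rw [← tsum_mul_left]
    exact hWs.tsum_le_tsum hWle ((hs u).mul_left _)
  have hN : (0 : ℝ) < (q * q' : ℕ) := by
    exact_mod_cast Nat.pos_of_ne_zero (mul_ne_zero hq hq')
  have hρ' : ‖∑ m ∈ Finset.range (q * q'), c m‖ ≤ ρ * (q * q' : ℕ) := by
    simpa [hc] using hρ
  rw [hsum]
  refine le_of_mul_le_mul_left (key.trans ?_) hN
  calc _ ≤ ρ * (q * q' : ℕ) * (B ^ 2 * ∑' w, decayWeight δ w * decayWeight δ (w + u)) +
        (q * q' : ℕ) * ((q * q' : ℕ) * ∑' w, V w) := by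
        refine add_le_add (mul_le_mul hρ' hWt (tsum_nonneg fun _ => norm_nonneg _) ?_) le_rfl
        exact (norm_nonneg _).trans hρ'
    _ = _ := by rw [hVt]; push_cast; ring

end IsAdaptedBump

/-- Schur's test for the linearized operator `T T*`. -/
lemma exists_sum_norm_tsum_conj_weylKernel_mul_le {d : ℕ} (hd : 2 ≤ d) {κ : ℝ} (hκ0 : 0 < κ)
    (hκ : κ < 1 / (d : ℝ) ^ 2) :
    ∃ C : ℝ, 0 < C ∧ ∀ (s : ℕ) (A δ : ℝ) (φ : ℝ → ℝ), 1 ≤ s → 0 < δ →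
      δ ≤ ((2 : ℝ) ^ (5 * s))⁻¹ → IsAdaptedBump A δ φ → ∀ (X : Finset ℤ) (a q : ℤ → ℕ),
      (∀ x, (a x).Coprime (q x) ∧ 2 ^ (s - 1) ≤ q x ∧ q x < 2 ^ s) → ∀ y,
      ∑ x ∈ X, ‖∑' n, (starRingEnd ℂ) (weylKernel d φ (a x) (q x) (x - n)) *
        weylKernel d φ (a y) (q y) (y - n)‖ ≤ C * A ^ 2 * (2 : ℝ) ^ (-(κ * s)) := by
  have hd2 : (2 : ℝ) ≤ d := by exact_mod_cast hd
  -- The room `κ₁ - κ` absorbs the divisor function.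
  set κ₁ : ℝ := (κ + 1 / (d : ℝ) ^ 2) / 2 with hκ₁
  have hκκ₁ : κ < κ₁ := by rw [hκ₁]; linarith
  have hκ₁d : κ₁ < 1 / (d : ℝ) ^ 2 := by rw [hκ₁]; linarith
  have hd1 : 1 / (d : ℝ) ^ 2 ≤ 1 := by rw [div_le_one (by positivity)]; nlinarith
  obtain ⟨K₀, hK₀, hK₀q⟩ := exists_norm_sum_range_e_sub_le hd (hκ0.le.trans hκκ₁.le) hκ₁d
  obtain ⟨K₁, hK₁, hK₁q⟩ := exists_card_divisors_le (sub_pos.2 hκκ₁)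
  refine ⟨300 ^ 2 * (K₀ * (4 * (4 * (K₁ * 2))) + 32), by positivity,
    fun s A δ φ hs hδ hδs hφ X a q haq y => ?_⟩
  have hq0 : ∀ x, q x ≠ 0 := fun x => (lt_of_lt_of_le (by positivity) (haq x).2.1).ne'
  have h2s : (1 : ℝ) ≤ 2 ^ s := one_le_pow₀ one_le_two
  have hδs' : δ * (2 : ℝ) ^ s ^ 1 * (2 ^ s) ^ 4 ≤ 1 := by
    have : (2 : ℝ) ^ (5 * s) = 2 ^ s * (2 ^ s) ^ 4 := by rw [← pow_mul, ← pow_add]; ring_nf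
    rw [pow_one, mul_assoc, ← this]
    calc _ ≤ ((2 : ℝ) ^ (5 * s))⁻¹ * 2 ^ (5 * s) := by gcongr
      _ = 1 := inv_mul_cancel₀ (by positivity)
  rw [pow_one] at hδs'
  have hδ2s : δ * (2 : ℝ) ^ s ≤ 1 := by
    refine le_trans ?_ hδs'
    exact le_mul_of_one_le_right (by positivity) (one_le_pow₀ h2s)
  have hδ1 : δ ≤ 1 := le_trans (le_mul_of_one_le_right hδ.le h2s) hδ2s
  have hqR : ∀ x, (q x : ℝ) ≤ 2 ^ s := fun x => by exact_mod_cast (haq x).2.2.le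
  have hqδ : (q y : ℝ) * δ ≤ 1 := by
    rw [mul_comm]
    exact (mul_le_mul_of_nonneg_left (hqR y) hδ.le).trans hδ2s
  set ρ : ℤ → ℝ := fun x => ((q y / Int.gcd (q y) (y - x) : ℕ) : ℝ) ^ (-κ₁) with hρ
  set I : ℤ → ℤ → ℝ := fun y x => ∑' w, decayWeight δ w * decayWeight δ (w + (y - x)) with hI
  have hI0 : ∀ y x, 0 ≤ I y x := fun y x => tsum_nonneg fun w =>
    mul_nonneg (decayWeight_nonneg hδ _) (decayWeight_nonneg hδ _)
  have hterm : ∀ x, ‖∑' n, (starRingEnd ℂ) (weylKernel d φ (a x) (q x) (x - n)) *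
      weylKernel d φ (a y) (q y) (y - n)‖ ≤
      (300 * A) ^ 2 * (K₀ * (ρ x * I y x) + (2 ^ s * 2 ^ s * δ) * (I (y + 1) x + I y x)) := by
    intro x
    refine (hφ.norm_tsum_conj_weylKernel_mul_le hδ hδ1 (hq0 x) (hq0 y) x y
      (hK₀q (a x) (q x) (a y) (q y) (y - x) (hq0 x) (hq0 y) (haq y).1)).trans ?_
    rw [mul_assoc K₀]
    have := hI0 y x
    have := hI0 (y + 1) x
    gcongr
    · exact hqR x
    · exact hqR y
  have hsum1 : ∑ x ∈ X, ρ x * I y x ≤ 4 * (4 * ((q y).divisors.card * (q y : ℝ) ^ (-κ₁))) :=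
    sum_mul_tsum_decayWeight_le hδ hδ1 y
      (fun z => sum_rpow_gcd_mul_decayWeight_le hδ (hκ₁d.le.trans hd1)
        (hq0 y) hqδ X y z) (by positivity)
  have hsum2 : ∀ y, ∑ x ∈ X, I y x ≤ 16 := by
    intro y
    have := sum_mul_tsum_decayWeight_le hδ hδ1 (X := X) (ρ := fun _ => 1) (M := 4) y (fun z => ?_)
      (by norm_num)
    · simp only [one_mul] at this
      linarith
    · have := sum_decayWeight_comp_sub_le hδ one_pos (by simpa using hδ1) X 0 z
      simpa using this
  have hqy : (0 : ℝ) < q y := by exact_mod_cast Nat.pos_of_ne_zero (hq0 y)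
  have hdecay : ((q y).divisors.card : ℝ) * (q y : ℝ) ^ (-κ₁) ≤ K₁ * 2 * (2 : ℝ) ^ (-(κ * s)) := by
    calc _ ≤ K₁ * (q y : ℝ) ^ (κ₁ - κ) * (q y : ℝ) ^ (-κ₁) := by gcongr; exact hK₁q _ (hq0 y)
      _ = K₁ * (q y : ℝ) ^ (-κ) := by rw [mul_assoc, ← Real.rpow_add hqy]; congr 2; ring
      _ ≤ K₁ * ((2 : ℝ) ^ ((s : ℝ) - 1)) ^ (-κ) := by
          refine mul_le_mul_of_nonneg_left (Real.rpow_le_rpow_of_nonpos (by positivity) ?_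
            (by linarith)) hK₁.le
          have h1 : ((s - 1 : ℕ) : ℝ) = (s : ℝ) - 1 := by push_cast [Nat.cast_sub hs]; ring
          rw [← h1, Real.rpow_natCast]
          exact_mod_cast (haq y).2.1
      _ = K₁ * ((2 : ℝ) ^ κ * (2 : ℝ) ^ (-(κ * s))) := by
          rw [← Real.rpow_mul two_pos.le, ← Real.rpow_add two_pos]
          congr 2
          ring
      _ ≤ K₁ * (2 * (2 : ℝ) ^ (-(κ * s))) := by
          gcongr
          conv_rhs => rw [← Real.rpow_one 2]
          exact Real.rpow_le_rpow_of_exponent_le one_le_two (by linarith)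
      _ = _ := by ring
  -- The averaging error is at most `2^(2s) · 2^(-5s)`, and `κ ≤ 1`.
  have herr : (2 : ℝ) ^ s * 2 ^ s * δ ≤ (2 : ℝ) ^ (-(κ * s)) := by
    have h1 : (2 : ℝ) ^ (κ * s) ≤ 2 ^ s := by
      rw [← Real.rpow_natCast 2 s]
      refine Real.rpow_le_rpow_of_exponent_le one_le_two ?_
      exact mul_le_of_le_one_left (by positivity) (by linarith)
    rw [Real.rpow_neg two_pos.le, le_inv_comm₀ (by positivity) (by positivity)]
    refine h1.trans ?_
    rw [← one_div, le_div_iff₀ (by positivity)]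
    refine le_trans ?_ hδs'
    have h2 : (1 : ℝ) ≤ (2 ^ s) ^ 2 := one_le_pow₀ h2s
    have h3 : (0 : ℝ) ≤ δ * (2 ^ s) ^ 3 := by positivity
    nlinarith [mul_le_mul_of_nonneg_left h2 h3]
  calc _ ≤ ∑ x ∈ X, (300 * A) ^ 2 *
        (K₀ * (ρ x * I y x) + (2 ^ s * 2 ^ s * δ) * (I (y + 1) x + I y x)) :=
        Finset.sum_le_sum fun x _ => hterm x
    _ = (300 * A) ^ 2 * (K₀ * ∑ x ∈ X, ρ x * I y x +
        (2 ^ s * 2 ^ s * δ) * (∑ x ∈ X, I (y + 1) x + ∑ x ∈ X, I y x)) := by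
        rw [← Finset.mul_sum, Finset.sum_add_distrib, ← Finset.mul_sum, ← Finset.mul_sum,
          Finset.sum_add_distrib]
    _ ≤ (300 * A) ^ 2 * (K₀ * (4 * (4 * (K₁ * 2 * (2 : ℝ) ^ (-(κ * s))))) +
        (2 : ℝ) ^ (-(κ * s)) * (16 + 16)) := by
        have hnn : ∀ y, 0 ≤ ∑ x ∈ X, I y x := fun y => Finset.sum_nonneg fun x _ => hI0 y x
        have := hnn y
        have := hnn (y + 1)
        gcongr
        · exact hsum1.trans (by gcongr)
        · exact hsum2 _
        · exact hsum2 _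
    _ = _ := by ring

/-! ### Interpolation with the trivial bounds. -/

/-- The number with the argument of `u` and modulus `‖u‖ ^ w`. -/
noncomputable def twist (w u : ℂ) : ℂ := u / ‖u‖ * Complex.exp (w * Real.log ‖u‖)

lemma twist_one (u : ℂ) : twist 1 u = u := by
  rcases eq_or_ne u 0 with rfl | hu
  · simp [twist]
  · have hu' : 0 < ‖u‖ := norm_pos_iff.2 hu
    rw [twist, one_mul, ← Complex.ofReal_exp, Real.exp_log hu']
    exact div_mul_cancel₀ u (by exact_mod_cast hu'.ne')

lemma norm_twist_le {w u : ℂ} {r a : ℝ} (hw : w.re = r * a) : ‖twist w u‖ ≤ (‖u‖ ^ r) ^ a := by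
  rcases eq_or_ne u 0 with rfl | hu
  · simp only [twist, zero_div, zero_mul, norm_zero]
    positivity
  · have hu' : 0 < ‖u‖ := norm_pos_iff.2 hu
    rw [twist, norm_mul, norm_div, Complex.norm_real, norm_norm, div_self hu'.ne', one_mul,
      Complex.norm_exp, ← Real.rpow_mul hu'.le, Real.rpow_def_of_pos hu', Complex.re_mul_ofReal, hw,
      mul_comm]

lemma differentiable_twist (u : ℂ) {w : ℂ → ℂ} (hw : Differentiable ℂ w) :
    Differentiable ℂ fun z => twist (w z) u := by
  unfold twist
  fun_prop

/-- Riesz–Thorin interpolation between the trivial bounds of a dominated kernel and an `ℓ²` bound,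
in bilinear form. -/
lemma norm_bilinear_le_interp {ι κ : Type*} {X : Finset ι} {S : Finset κ} {k : ι → κ → ℂ}
    {W : ι → κ → ℝ} {B γ α θ p p' : ℝ} (hB : 0 ≤ B) (hγ : 0 ≤ γ) (hkW : ∀ x n, ‖k x n‖ ≤ W x n)
    (hrow : ∀ x, ∑ n ∈ S, W x n ≤ B) (hcol : ∀ n, ∑ x ∈ X, W x n ≤ B)
    (hL2 : ∀ f : κ → ℂ, ∑ x ∈ X, ‖∑ n ∈ S, f n * k x n‖ ^ 2 ≤ γ ^ 2 * ∑ n ∈ S, ‖f n‖ ^ 2)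
    (hα0 : 0 ≤ α) (hα1 : α ≤ 1) (hθ0 : 0 ≤ θ) (hθ1 : θ ≤ 1) (hp : 0 < p) (hp' : 0 < p')
    (hpθ : 1 / p = (1 - θ) * α + θ / 2) (hpp' : 1 / p' = 1 - 1 / p) (f : κ → ℂ) (g : ι → ℂ)
    (hf : ∑ n ∈ S, ‖f n‖ ^ p ≤ 1) (hg : ∑ x ∈ X, ‖g x‖ ^ p' ≤ 1) :
    ‖∑ x ∈ X, g x * ∑ n ∈ S, f n * k x n‖ ≤ B ^ (1 - θ) * γ ^ θ := by
  set β : ℂ → ℂ := fun z => (1 - z) * α + z / 2 with hβ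
  have hβre : ∀ z, (β z).re = (1 - z.re) * α + z.re / 2 := by
    intro z
    simp [hβ]
  have hβd : Differentiable ℂ β := by simp only [hβ]; fun_prop
  set F : ℂ → κ → ℂ := fun z n => twist (p * β z) (f n) with hF
  set G : ℂ → ι → ℂ := fun z x => twist (p' * (1 - β z)) (g x) with hG
  set H : ℂ → ℂ := fun z => ∑ x ∈ X, G z x * ∑ n ∈ S, F z n * k x n with hH
  have hW0 : ∀ x n, 0 ≤ W x n := fun x n => (norm_nonneg _).trans (hkW x n)
  have hFle : ∀ z n, ‖F z n‖ ≤ (‖f n‖ ^ p) ^ ((1 - z.re) * α + z.re / 2) := by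
    intro z n
    refine norm_twist_le ?_
    rw [Complex.re_ofReal_mul, hβre]
  have hGle : ∀ z x, ‖G z x‖ ≤ (‖g x‖ ^ p') ^ (1 - ((1 - z.re) * α + z.re / 2)) := by
    intro z x
    refine norm_twist_le ?_
    rw [Complex.re_ofReal_mul, Complex.sub_re, hβre, Complex.one_re]
  have hf1 : ∀ n ∈ S, ‖f n‖ ^ p ≤ 1 := fun n hn =>
    (Finset.single_le_sum (f := fun n => ‖f n‖ ^ p) (fun _ _ => by positivity) hn).trans hf
  have hg1 : ∀ x ∈ X, ‖g x‖ ^ p' ≤ 1 := fun x hx =>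
    (Finset.single_le_sum (f := fun x => ‖g x‖ ^ p') (fun _ _ => by positivity) hx).trans hg
  have hHd : Differentiable ℂ H := by
    simp only [hH, hF, hG]
    refine Differentiable.fun_sum fun x _ => Differentiable.mul
      (differentiable_twist _ (by fun_prop)) (Differentiable.fun_sum fun n _ => Differentiable.mul
        (differentiable_twist _ (by fun_prop)) (by fun_prop))
  have hHnorm : ∀ z, ‖H z‖ ≤ ∑ x ∈ X, ∑ n ∈ S, W x n * (‖F z n‖ * ‖G z x‖) := by
    intro z
    refine (norm_sum_le _ _).trans (Finset.sum_le_sum fun x _ => ?_)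
    rw [Finset.mul_sum]
    refine (norm_sum_le _ _).trans (Finset.sum_le_sum fun n _ => ?_)
    rw [norm_mul, norm_mul]
    calc _ = ‖k x n‖ * (‖F z n‖ * ‖G z x‖) := by ring
      _ ≤ _ := by gcongr; exact hkW x n
  -- By normalization each `‖f n‖^p` and `‖g x‖^p'` is at most 1, and both exponents are nonnegative
  -- on the strip.
  have hbdd : BddAbove ((norm ∘ H) '' Complex.HadamardThreeLines.verticalClosedStrip 0 1) := by
    refine ⟨∑ x ∈ X, ∑ n ∈ S, W x n, ?_⟩
    rintro _ ⟨z, hz, rfl⟩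
    have hz0 : 0 ≤ z.re := hz.1
    have hz1 : z.re ≤ 1 := hz.2
    have he0 : 0 ≤ (1 - z.re) * α + z.re / 2 := by
      have : 0 ≤ (1 - z.re) * α := mul_nonneg (by linarith) hα0
      linarith
    have he1 : 0 ≤ 1 - ((1 - z.re) * α + z.re / 2) := by
      have : (1 - z.re) * α ≤ 1 - z.re := mul_le_of_le_one_right (by linarith) hα1
      linarith
    refine (hHnorm z).trans (Finset.sum_le_sum fun x hx => Finset.sum_le_sum fun n hn => ?_)
    refine mul_le_of_le_one_right (hW0 x n) (mul_le_one₀ ((hFle z n).trans ?_) (norm_nonneg _)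
      ((hGle z x).trans ?_))
    · exact Real.rpow_le_one (by positivity) (hf1 n hn) he0
    · exact Real.rpow_le_one (by positivity) (hg1 x hx) he1
  -- Weighted AM-GM splits the product into a part in `f`, controlled by column sums, and a part in
  -- `g`, controlled by row sums.
  have hedge0 : ∀ z ∈ Complex.re ⁻¹' {(0 : ℝ)}, ‖H z‖ ≤ B := by
    intro z hz
    have hz : z.re = 0 := hz
    calc ‖H z‖ ≤ ∑ x ∈ X, ∑ n ∈ S, W x n * (α * ‖f n‖ ^ p + (1 - α) * ‖g x‖ ^ p') := by
          refine (hHnorm z).trans (Finset.sum_le_sum fun x hx => Finset.sum_le_sum fun n hn =>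
            mul_le_mul_of_nonneg_left ?_ (hW0 x n))
          have h1 := hFle z n
          have h2 := hGle z x
          rw [hz, sub_zero, one_mul, zero_div, add_zero] at h1 h2
          exact (mul_le_mul h1 h2 (norm_nonneg _) (by positivity)).trans
            (Real.geom_mean_le_arith_mean2_weighted hα0 (by linarith) (by positivity)
              (by positivity) (by ring))
      _ = α * ∑ n ∈ S, ‖f n‖ ^ p * ∑ x ∈ X, W x n +
          (1 - α) * ∑ x ∈ X, ‖g x‖ ^ p' * ∑ n ∈ S, W x n := by
          simp_rw [mul_add, Finset.sum_add_distrib, Finset.mul_sum]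
          rw [Finset.sum_comm (s := S)]
          congr 1 <;>
          refine Finset.sum_congr rfl fun x _ => Finset.sum_congr rfl fun n _ => by ring
      _ ≤ α * B + (1 - α) * B := by
          have h1 : ∑ n ∈ S, ‖f n‖ ^ p * ∑ x ∈ X, W x n ≤ B := by
            calc _ ≤ ∑ n ∈ S, ‖f n‖ ^ p * B := by gcongr; exact hcol _
              _ ≤ B := by rw [← Finset.sum_mul]; exact mul_le_of_le_one_left hB hf
          have h2 : ∑ x ∈ X, ‖g x‖ ^ p' * ∑ n ∈ S, W x n ≤ B := by
            calc _ ≤ ∑ x ∈ X, ‖g x‖ ^ p' * B := by gcongr; exact hrow _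
              _ ≤ B := by rw [← Finset.sum_mul]; exact mul_le_of_le_one_left hB hg
          have : 0 ≤ 1 - α := by linarith
          gcongr
      _ = B := by ring
  -- Here both deformed functions are in the unit ball of `ℓ²`, so Cauchy–Schwarz and the `ℓ²` bound
  -- apply.
  have hedge1 : ∀ z ∈ Complex.re ⁻¹' {(1 : ℝ)}, ‖H z‖ ≤ γ := by
    intro z hz
    have hz : z.re = 1 := hz
    have hhalf : ∀ t : ℝ, 0 ≤ t → (t ^ (1 / 2 : ℝ)) ^ 2 = t := fun t ht => by
      rw [← Real.sqrt_eq_rpow, Real.sq_sqrt ht]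
    have hF2 : ∑ n ∈ S, ‖F z n‖ ^ 2 ≤ 1 := by
      refine (Finset.sum_le_sum fun n _ => ?_).trans hf
      have h1 := hFle z n
      rw [hz, sub_self, zero_mul, zero_add] at h1
      exact (pow_le_pow_left₀ (norm_nonneg _) h1 2).trans_eq (hhalf _ (by positivity))
    have hG2 : ∑ x ∈ X, ‖G z x‖ ^ 2 ≤ 1 := by
      refine (Finset.sum_le_sum fun x _ => ?_).trans hg
      have h1 := hGle z x
      rw [hz, sub_self, zero_mul, zero_add, show (1 : ℝ) - 1 / 2 = 1 / 2 by norm_num] at h1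
      exact (pow_le_pow_left₀ (norm_nonneg _) h1 2).trans_eq (hhalf _ (by positivity))
    have hsq : ‖H z‖ ^ 2 ≤ γ ^ 2 := by
      calc ‖H z‖ ^ 2 ≤ (∑ x ∈ X, ‖G z x‖ * ‖∑ n ∈ S, F z n * k x n‖) ^ 2 := by
            gcongr
            refine (norm_sum_le _ _).trans (le_of_eq (Finset.sum_congr rfl fun x _ => norm_mul _ _))
        _ ≤ (∑ x ∈ X, ‖G z x‖ ^ 2) * ∑ x ∈ X, ‖∑ n ∈ S, F z n * k x n‖ ^ 2 :=
            Finset.sum_mul_sq_le_sq_mul_sq _ _ _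
        _ ≤ 1 * (γ ^ 2 * 1) := by
            gcongr
            exact (hL2 _).trans (by gcongr)
        _ = γ ^ 2 := by ring
    exact le_of_sq_le_sq hsq hγ
  have hθz : ((θ : ℂ)) ∈ Complex.HadamardThreeLines.verticalClosedStrip 0 1 := by
    exact ⟨by simpa using hθ0, by simpa using hθ1⟩
  have key := Complex.HadamardThreeLines.norm_le_interp_of_mem_verticalClosedStrip₀₁' H hθz
    hHd.diffContOnCl hbdd hedge0 hedge1
  have hβθ : β θ = ((1 / p : ℝ) : ℂ) := by
    rw [hpθ, hβ]; push_cast; ring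
  have hFθ : ∀ n, F θ n = f n := by
    intro n
    simp only [hF, hβθ]
    rw [← Complex.ofReal_mul, mul_one_div_cancel hp.ne', Complex.ofReal_one, twist_one]
  have hGθ : ∀ x, G θ x = g x := by
    intro x
    simp only [hG, hβθ]
    rw [← Complex.ofReal_one, ← Complex.ofReal_sub, ← hpp', ← Complex.ofReal_mul,
      mul_one_div_cancel hp'.ne', Complex.ofReal_one, twist_one]
  simpa [hH, hFθ, hGθ] using key

/-- Riesz–Thorin interpolation between the trivial bounds of a dominated kernel and an `ℓ²` bound. -/
lemma sum_norm_rpow_le_interp {ι κ : Type*} {X : Finset ι} {S : Finset κ} {k : ι → κ → ℂ}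
    {W : ι → κ → ℝ} {B γ α θ p : ℝ} (hB : 0 ≤ B) (hγ : 0 ≤ γ) (hkW : ∀ x n, ‖k x n‖ ≤ W x n)
    (hrow : ∀ x, ∑ n ∈ S, W x n ≤ B) (hcol : ∀ n, ∑ x ∈ X, W x n ≤ B)
    (hL2 : ∀ f : κ → ℂ, ∑ x ∈ X, ‖∑ n ∈ S, f n * k x n‖ ^ 2 ≤ γ ^ 2 * ∑ n ∈ S, ‖f n‖ ^ 2)
    (hα0 : 0 ≤ α) (hα1 : α ≤ 1) (hθ0 : 0 ≤ θ) (hθ1 : θ ≤ 1) (hp : 1 < p)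
    (hpθ : 1 / p = (1 - θ) * α + θ / 2) (f : κ → ℂ) :
    ∑ x ∈ X, ‖∑ n ∈ S, f n * k x n‖ ^ p ≤
      (B ^ (1 - θ) * γ ^ θ) ^ p * ∑ n ∈ S, ‖f n‖ ^ p := by
  have hp0 : 0 < p := by linarith
  set Γ := B ^ (1 - θ) * γ ^ θ with hΓ
  have hΓ0 : 0 ≤ Γ := by positivity
  set T : ι → ℂ := fun x => ∑ n ∈ S, f n * k x n with hT
  set P := ∑ n ∈ S, ‖f n‖ ^ p with hP
  set Q := ∑ x ∈ X, ‖T x‖ ^ p with hQ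
  have hP0 : 0 ≤ P := by positivity
  have hQ0 : 0 ≤ Q := by positivity
  rcases hQ0.eq_or_lt with hQz | hQpos
  · rw [← hQz]; positivity
  rcases hP0.eq_or_lt with hPz | hPpos
  · exfalso
    have hfz : ∀ n ∈ S, f n = 0 := by
      intro n hn
      have := (Finset.sum_eq_zero_iff_of_nonneg fun n _ => by positivity).1 hPz.symm n hn
      simpa [Real.rpow_eq_zero (norm_nonneg _) hp0.ne'] using this
    have : Q = 0 := Finset.sum_eq_zero fun x _ => by
      simp only [hT]
      rw [Finset.sum_eq_zero fun n hn => by rw [hfz n hn, zero_mul], norm_zero,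
        Real.zero_rpow hp0.ne']
    exact hQpos.ne' this
  set p' := p / (p - 1) with hp'
  have hp'0 : 0 < p' := div_pos hp0 (by linarith)
  have hpp' : 1 / p' = 1 - 1 / p := by rw [hp']; field_simp
  set f₀ : κ → ℂ := fun n => f n / ((P ^ (1 / p) : ℝ) : ℂ) with hf₀
  -- The normalized extremal function for the duality between `ℓ^p` and `ℓ^p'`.
  set g₀ : ι → ℂ := fun x => (starRingEnd ℂ) (T x) * ((‖T x‖ ^ (p - 2) / Q ^ (1 / p') : ℝ) : ℂ) with hg₀
  have hroot : ∀ t r : ℝ, 0 < t → 0 < r → (t ^ (1 / r)) ^ r = t := fun t r ht hr => by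
    rw [← Real.rpow_mul ht.le, one_div_mul_cancel hr.ne', Real.rpow_one]
  have hPr : 0 < P ^ (1 / p) := by positivity
  have hQr : 0 < Q ^ (1 / p') := by positivity
  have hfn : ∑ n ∈ S, ‖f₀ n‖ ^ p ≤ 1 := by
    have : ∀ n, ‖f₀ n‖ ^ p = ‖f n‖ ^ p / P := by
      intro n
      simp only [hf₀]
      rw [norm_div, Complex.norm_real, Real.norm_of_nonneg hPr.le,
        Real.div_rpow (norm_nonneg _) hPr.le, hroot P p hPpos hp0]
    simp_rw [this]
    rw [← Finset.sum_div, ← hP, div_self hPpos.ne']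
  have hTmul : ∀ x, ‖T x‖ * ‖T x‖ ^ (p - 2) = ‖T x‖ ^ (p - 1) := by
    intro x
    rcases (norm_nonneg (T x)).eq_or_lt with h | h
    · rw [← h, zero_mul, Real.zero_rpow (by linarith)]
    · rw [← Real.rpow_one_add' h.le (by linarith)]
      congr 1
      ring
  have hgn : ∑ x ∈ X, ‖g₀ x‖ ^ p' ≤ 1 := by
    have : ∀ x, ‖g₀ x‖ ^ p' = ‖T x‖ ^ p / Q := by
      intro x
      simp only [hg₀]
      rw [norm_mul, Complex.norm_conj, Complex.norm_real, Real.norm_of_nonneg (by positivity),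
        ← mul_div_assoc, hTmul, Real.div_rpow (by positivity) hQr.le, hroot Q p' hQpos hp'0,
        ← Real.rpow_mul (norm_nonneg _)]
      congr 2
      rw [hp']
      have : p - 1 ≠ 0 := by linarith
      field_simp
    simp_rw [this]
    rw [← Finset.sum_div, ← hQ, div_self hQpos.ne']
  have key := norm_bilinear_le_interp hB hγ hkW hrow hcol hL2 hα0 hα1 hθ0 hθ1 hp0 hp'0 hpθ hpp' f₀ g₀
    hfn hgn
  have hval : ∑ x ∈ X, g₀ x * ∑ n ∈ S, f₀ n * k x n =
      ((Q / (Q ^ (1 / p') * P ^ (1 / p)) : ℝ) : ℂ) := by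
    have h1 : ∀ x, g₀ x * ∑ n ∈ S, f₀ n * k x n =
        ((‖T x‖ ^ p / (Q ^ (1 / p') * P ^ (1 / p)) : ℝ) : ℂ) := by
      intro x
      have h2 : ∑ n ∈ S, f₀ n * k x n = T x / ((P ^ (1 / p) : ℝ) : ℂ) := by
        simp only [hT, hf₀]
        rw [Finset.sum_div]
        exact Finset.sum_congr rfl fun n _ => by ring
      have h3 : ‖T x‖ ^ p = ‖T x‖ ^ 2 * ‖T x‖ ^ (p - 2) := by
        rw [pow_two, mul_assoc, hTmul]
        rcases (norm_nonneg (T x)).eq_or_lt with h | h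
        · rw [← h, zero_mul, Real.zero_rpow hp0.ne']
        · rw [← Real.rpow_one_add' h.le (by linarith)]
          congr 1
          ring
      rw [h2, h3]
      simp only [hg₀]
      push_cast
      rw [← Complex.mul_conj']
      field_simp
    simp_rw [h1]
    rw [← Complex.ofReal_sum, ← Finset.sum_div]
  rw [hval, Complex.norm_real, Real.norm_of_nonneg (by positivity)] at key
  have hQsplit : Q = Q ^ (1 / p) * Q ^ (1 / p') := by
    rw [← Real.rpow_add hQpos, hpp', add_sub_cancel, Real.rpow_one]
  have h4 : Q ^ (1 / p) ≤ Γ * P ^ (1 / p) := by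
    rw [div_le_iff₀ (by positivity)] at key
    nth_rw 1 [hQsplit] at key
    refine le_of_mul_le_mul_right (key.trans_eq ?_) hQr
    ring
  calc Q = (Q ^ (1 / p)) ^ p := (hroot Q p hQpos hp0).symm
    _ ≤ (Γ * P ^ (1 / p)) ^ p := Real.rpow_le_rpow (by positivity) h4 hp0.le
    _ = Γ ^ p * P := by rw [Real.mul_rpow hΓ0 hPr.le, hroot P p hPpos hp0]

/-! ### Linearization of the supremum and conclusion. -/

lemma exists_maximalFunction_le {A δ : ℝ} {φ : ℝ → ℝ} (h : IsAdaptedBump A δ φ) (hδ : δ ≤ 1)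
    (d : ℕ) {s : ℕ} (hs : 1 ≤ s) (f : ℤ →₀ ℂ) (x : ℤ) :
    ∃ a q : ℕ, (a.Coprime q ∧ 2 ^ (s - 1) ≤ q ∧ q < 2 ^ s) ∧
      maximalFunction d s φ f x ≤ ‖∑ n ∈ f.support, f n * weylKernel d φ a q (x - n)‖ₑ := by
  set P : Finset (ℕ × ℕ) := (Finset.range (2 ^ s + 1) ×ˢ Finset.range (2 ^ s + 1)).filter
    fun r => r.1.Coprime r.2 ∧ 2 ^ (s - 1) ≤ r.2 ∧ r.2 < 2 ^ s with hP
  have hne : P.Nonempty := by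
    have h1 : 1 ≤ 2 ^ s := Nat.one_le_two_pow
    have h2 : 2 ^ (s - 1) < 2 ^ s := Nat.pow_lt_pow_right one_lt_two (by omega)
    -- An admissible fraction always exists, so every `x` gets a reduced one even where the supremum
    -- is zero.
    refine ⟨(1, 2 ^ (s - 1)), Finset.mem_filter.2 ⟨Finset.mem_product.2 ⟨?_, ?_⟩, ?_⟩⟩
    · simp only [Finset.mem_range]; omega
    · simp only [Finset.mem_range]; omega
    · exact ⟨Nat.coprime_one_left _, le_rfl, h2⟩
  obtain ⟨⟨a, q⟩, haq, hmax⟩ := P.exists_max_image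
    (fun r => ‖∑ n ∈ f.support, f n * weylKernel d φ r.1 r.2 (x - n)‖) hne
  refine ⟨a, q, (Finset.mem_filter.1 haq).2, ?_⟩
  refine iSup_le fun q' => iSup_le fun a' => iSup_le fun hr => ?_
  by_cases hs' : 2 ^ (s - 1) ≤ q' ∧ q' < 2 ^ s
  · rw [h.weylMultiplier_eq hδ hs']
    split_ifs with hcop
    · rw [enorm_le_iff_norm_le]
      refine hmax (a', q') (Finset.mem_filter.2 ⟨Finset.mem_product.2 ⟨?_, ?_⟩, hcop, hs'⟩)
      · simp only [Finset.mem_range]; omega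
      · simp only [Finset.mem_range]; omega
    · simp
  · rw [weylMultiplier_eq_zero hs']
    simp

lemma decayWeight_neg (δ : ℝ) (m : ℤ) : decayWeight δ (-m) = decayWeight δ m := by
  simp [decayWeight]

lemma sum_decayWeight_sub_le {δ : ℝ} (hδ : 0 < δ) (hδ1 : δ ≤ 1) (X : Finset ℤ) (z : ℤ) :
    ∑ x ∈ X, decayWeight δ (z - x) ≤ 4 := by
  simpa using sum_decayWeight_comp_sub_le hδ one_pos (by simpa using hδ1) X 0 z

lemma enorm_rpow_eq_ofReal (z : ℂ) {p : ℝ} (hp : 0 ≤ p) : ‖z‖ₑ ^ p = ENNReal.ofReal (‖z‖ ^ p) := by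
  rw [← ofReal_norm, ENNReal.ofReal_rpow_of_nonneg (norm_nonneg _) hp]

/-- The maximal estimate on `ℓ^p`, where `p` is the exponent at the point `θ` of the
segment from `1 / p = α` to `1 / p = 1 / 2`. -/
lemma decayEstimate_of_interp {d : ℕ} (hd : 2 ≤ d) {κ p α θ : ℝ} (hκ0 : 0 < κ)
    (hκ : κ < 1 / (d : ℝ) ^ 2) (hα0 : 0 ≤ α) (hα1 : α ≤ 1) (hθ0 : 0 ≤ θ) (hθ1 : θ ≤ 1) (hp : 1 < p)
    (hpθ : 1 / p = (1 - θ) * α + θ / 2) : DecayEstimate d p (κ / 2 * θ) := by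
  obtain ⟨C, hC, hschur⟩ := exists_sum_norm_tsum_conj_weylKernel_mul_le hd hκ0 hκ
  have hp0 : 0 < p := by linarith
  intro A
  -- `1200 A` is the kernel constant `300 A` times the mass 4 of the weight. The factor `√C * A`
  -- comes from the square root of the Schur bound.
  refine ⟨(1200 * A) ^ (1 - θ) * (√C * A) ^ θ, fun s hs δ hδ hδs φ hφ f => ?_⟩
  have hA := hφ.nonneg
  have hδ1 : δ ≤ 1 := hδs.trans (inv_le_one_of_one_le₀ (one_le_pow₀ one_le_two))
  choose a q haq hM using exists_maximalFunction_le hφ hδ1 d hs f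
  set γ : ℝ := √C * A * (2 : ℝ) ^ (-(κ / 2 * s)) with hγ
  have hγ0 : 0 ≤ γ := by positivity
  have hγsq : γ ^ 2 = C * A ^ 2 * (2 : ℝ) ^ (-(κ * s)) := by
    rw [hγ, mul_pow, mul_pow, Real.sq_sqrt hC.le, ← Real.rpow_natCast ((2 : ℝ) ^ _),
      ← Real.rpow_mul two_pos.le]
    congr 2
    push_cast
    ring
  set Γ : ℝ := (1200 * A) ^ (1 - θ) * γ ^ θ with hΓ
  have hΓ0 : 0 ≤ Γ := by positivity
  have hΓeq : (1200 * A) ^ (1 - θ) * (√C * A) ^ θ * (2 : ℝ) ^ (-(κ / 2 * θ * s)) = Γ := by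
    rw [hΓ, hγ, Real.mul_rpow (x := √C * A) (by positivity) (by positivity), ← Real.rpow_mul two_pos.le, ← mul_assoc]
    congr 2
    ring
  have hfin : ∀ X : Finset ℤ,
      ∑ x ∈ X, ‖∑ n ∈ f.support, f n * weylKernel d φ (a x) (q x) (x - n)‖ ^ p ≤
        Γ ^ p * ∑ n ∈ f.support, ‖f n‖ ^ p := by
    intro X
    refine sum_norm_rpow_le_interp (by positivity) hγ0
      (W := fun x n => 300 * A * decayWeight δ (x - n))
      (fun x n => hφ.norm_weylKernel_le hδ _ _ _ _) (fun x => ?_) (fun n => ?_) (fun g => ?_)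
      hα0 hα1 hθ0 hθ1 hp hpθ f
    · rw [← Finset.mul_sum]
      have := mul_le_mul_of_nonneg_left (sum_decayWeight_sub_le hδ hδ1 f.support x)
        (by positivity : 0 ≤ 300 * A)
      linarith
    · rw [← Finset.mul_sum]
      have := mul_le_mul_of_nonneg_left (sum_decayWeight_sub_le hδ hδ1 X n)
        (by positivity : 0 ≤ 300 * A)
      simp_rw [← decayWeight_neg δ (n - _), neg_sub] at this
      linarith
    · rw [hγsq]
      exact sum_norm_sq_le_of_schur (by positivity)
        (fun x _ y _ => hφ.summable_conj_weylKernel_mul hδ hδ1 _ _ _ _ _ _ _)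
        (fun y _ => hschur s A δ φ hs hδ hδs hφ X a q haq y) g
  have hpne : ENNReal.ofReal p ≠ 0 := by simpa using hp0
  rw [hΓeq, eLpNorm_eq_lintegral_rpow_enorm_toReal hpne ENNReal.ofReal_ne_top,
    eLpNorm_eq_lintegral_rpow_enorm_toReal hpne ENNReal.ofReal_ne_top, ENNReal.toReal_ofReal hp0.le,
    lintegral_count, lintegral_count]
  have hmain : ∑' x, ‖maximalFunction d s φ f x‖ₑ ^ p ≤
      ENNReal.ofReal Γ ^ p * ∑' x, ‖f x‖ₑ ^ p := by
    rw [ENNReal.tsum_eq_iSup_sum]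
    refine iSup_le fun X => ?_
    calc _ ≤ ∑ x ∈ X, ‖∑ n ∈ f.support, f n * weylKernel d φ (a x) (q x) (x - n)‖ₑ ^ p :=
          Finset.sum_le_sum fun x _ => ENNReal.rpow_le_rpow (hM x) hp0.le
      _ = ENNReal.ofReal (∑ x ∈ X,
          ‖∑ n ∈ f.support, f n * weylKernel d φ (a x) (q x) (x - n)‖ ^ p) := by
          rw [ENNReal.ofReal_sum_of_nonneg fun _ _ => by positivity]
          exact Finset.sum_congr rfl fun x _ => enorm_rpow_eq_ofReal _ hp0.le
      _ ≤ ENNReal.ofReal (Γ ^ p * ∑ n ∈ f.support, ‖f n‖ ^ p) := ENNReal.ofReal_le_ofReal (hfin X)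
      _ = ENNReal.ofReal Γ ^ p * ∑ n ∈ f.support, ‖f n‖ₑ ^ p := by
          rw [ENNReal.ofReal_mul (by positivity), ENNReal.ofReal_rpow_of_nonneg hΓ0 hp0.le,
            ENNReal.ofReal_sum_of_nonneg fun _ _ => by positivity]
          congr 1
          exact Finset.sum_congr rfl fun n _ => (enorm_rpow_eq_ofReal _ hp0.le).symm
      _ ≤ _ := by
          gcongr
          exact ENNReal.sum_le_tsum _
  calc _ ≤ (ENNReal.ofReal Γ ^ p * ∑' x, ‖f x‖ₑ ^ p) ^ (1 / p) :=
        ENNReal.rpow_le_rpow hmain (by positivity)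
    _ = _ := by
        rw [ENNReal.mul_rpow_of_nonneg _ _ (by positivity), ← ENNReal.rpow_mul,
          mul_one_div_cancel hp0.ne', ENNReal.rpow_one]

lemma DecayEstimate.mono {d : ℕ} {p η η' : ℝ} (h : DecayEstimate d p η) (hη : η' ≤ η) :
    DecayEstimate d p η' := by
  intro A
  obtain ⟨C, hC⟩ := h A
  refine ⟨|C|, fun s hs δ hδ hδs φ hφ f => (hC s hs δ hδ hδs φ hφ f).trans ?_⟩
  gcongr
  · exact le_abs_self C
  · exact one_le_two

end WeylMax

theorem mainTheorem5 (d : ℕ) (hd : 2 ≤ d) :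
    (∀ p : ℝ, 1 < p → ∃ η : ℝ, 0 < η ∧ WeylMax.DecayEstimate d p η) ∧
    (∀ ε : ℝ, 0 < ε → WeylMax.DecayEstimate d 2 (1 / (2 * (d : ℝ) ^ 2) - ε)) := by
  have hd0 : (0 : ℝ) < d := by exact_mod_cast (by omega : 0 < d)
  have hdpos : 0 < 1 / (d : ℝ) ^ 2 := by positivity
  refine ⟨fun p hp => ?_, fun ε hε => ?_⟩
  · have hp0 : 0 < p := by linarith
    have hκ : 1 / (d : ℝ) ^ 2 / 2 < 1 / (d : ℝ) ^ 2 := by linarith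
    have hp1 : 1 / p < 1 := by rw [div_lt_one hp0]; exact hp
    have hp2 : 0 < 1 / p := by positivity
    rcases le_total (1 / p) (1 / 2) with h | h
    -- For `p ≥ 2` interpolate from `ℓ^∞` (`α = 0`) with `θ = 2/p`; for `p ≤ 2`, from `ℓ¹` (`α = 1`)
    -- with `θ = 2 (1 - 1/p)`.
    · exact ⟨_, mul_pos (by positivity) (by positivity : 0 < 2 * (1 / p)),
        WeylMax.decayEstimate_of_interp hd (half_pos hdpos) hκ le_rfl zero_le_one (by positivity)
          (by linarith) hp (by ring)⟩
    · exact ⟨_, mul_pos (by positivity) (by linarith : 0 < 2 * (1 - 1 / p)),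
        WeylMax.decayEstimate_of_interp hd (half_pos hdpos) hκ zero_le_one le_rfl (by linarith)
          (by linarith) hp (by ring)⟩
  · have hhalf : 1 / (2 * (d : ℝ) ^ 2) = 1 / (d : ℝ) ^ 2 / 2 := by field_simp
    -- The maximum keeps `κ` positive when `ε` is large. At `p = 2`, `θ = 1` and the gain is `κ /
    -- 2`.
    set κ : ℝ := max (1 / (d : ℝ) ^ 2 - 2 * ε) (1 / (d : ℝ) ^ 2 / 2) with hκdef
    have hκ0 : 0 < κ := lt_max_of_lt_right (half_pos hdpos)
    have hκ : κ < 1 / (d : ℝ) ^ 2 := max_lt (by linarith) (by linarith)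
    refine (WeylMax.decayEstimate_of_interp hd hκ0 hκ le_rfl zero_le_one zero_le_one le_rfl one_lt_two
      (by norm_num)).mono ?_
    have : 1 / (d : ℝ) ^ 2 - 2 * ε ≤ κ := le_max_left _ _
    linarith
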